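/- Let $k$ be a field. A pair $\{\Phi_1,\Phi_2\}$ of alternating $m\times m$ matrices over $k$ (i.e. $u\Phi_iu^{\mathrm{tr}}=0$ for all $u\in k^m$) represents the alternating bimap $\circ\colon k^m\times k^m\to k^2$, $u\circ v=(u\Phi_1v^{\mathrm{tr}},\,u\Phi_2v^{\mathrm{tr}})$. The pair is *indecomposable* if $m>0$ and $k^m$ is not the direct sum of two nonzero subspaces orthogonal to each other with respect to both forms; it is *sloped* if some linear combination $a\Phi_1+b\Phi_2$ $(a,b\in k)$ is invertible (i.e. after a change of basis of $k^2$ the first form is nondegenerate). For a sloped pair there is a basis of $k^m$ relative to which $\Phi_i=\begin{bmatrix}0&\Psi_i\\-\Psi_i^{\mathrm{tr}}&0\end{bmatrix}$ for $i=1,2$ with $\Psi_1,\Psi_2$ square, and its *generalized Pfaffian* is $\mathrm{Pf}(\Phi_1,\Phi_2)=\det(x\Psi_1+y\Psi_2)\in k[x,y]$, which is defined up to a nonzero scalar. An element $\hat\alpha=\left(\begin{bmatrix}a&b\\c&d\end{bmatrix},\tau\right)$ of $\Gamma\mathrm{L}(2,k)=\mathrm{GL}(2,k)\rtimes\mathrm{Gal}(k)$,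 where $\mathrm{Gal}(k)=\mathrm{Aut}(k)$, acts on row vectors $w\in k^2$ by $w\hat\alpha=w^\tau\begin{bmatrix}a&b\\c&d\end{bmatrix}$ and on polynomials by $f^{\hat\alpha}(x,y)=f^\tau(ax+by,\,cx+dy)$, where $f^\tau$ is obtained by applying $\tau$ to the coefficients of $f$. A *pseudo-isometry* $(\alpha,\hat\alpha)$ from a bimap $\circ$ on $V$ to a bimap $\bullet$ on $V'$, both with values in $k^2$, consists of a semilinear bijection $\alpha\colon V\to V'$ and $\hat\alpha\in\Gamma\mathrm{L}(2,k)$ with $u\alpha\bullet v\alpha=(u\circ v)\hat\alpha$ for all $u,v\in V$. **Theorem.** Let $\{\Phi_1,\Phi_2\}$ and $\{\Lambda_1,\Lambda_2\}$ be pairs of alternating forms over $k$, each written relative to a fully refined orthogonal decomposition: for $i=1,2$, $$\Phi_i=\mathrm{diag}\big(\Phi_i^{(1)},\dots,\Phi_i^{(s)}\big),\qquad \Lambda_i=\mathrm{diag}\big(\Lambda_i^{(1)},\dots,\Lambda_i^{(t)}\big),$$ where all the pairs $\{\Phi_1^{(j)},\Phi_2^{(j)}\}$ and $\{\Lambda_1^{(j)},\Lambda_2^{(j)}\}$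 are indecomposable and sloped. Let $\hat\alpha\in\Gamma\mathrm{L}(2,k)$. There is an $\alpha$ such that $(\alpha,\hat\alpha)$ is a pseudo-isometry from (the bimap of) $\{\Phi_1,\Phi_2\}$ to (the bimap of) $\{\Lambda_1,\Lambda_2\}$ if and only if $s=t$ and there is a permutation $\sigma$ of $\{1,\dots,s\}$ such that for all $i$ $$\mathrm{Pf}\big(\Phi_1^{(i)},\Phi_2^{(i)}\big)^{\hat\alpha}\equiv\mathrm{Pf}\big(\Lambda_1^{(i\sigma)},\Lambda_2^{(i\sigma)}\big)\pmod{k^\times}.$$ -/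

import Mathlib

open Matrix

/-- The bimap `k^ι × k^ι → k²`, `u ∘ v = (u Φ₁ vᵗ, u Φ₂ vᵗ)`, represented by a pair of matrices.
The pair `{Φ₁, Φ₂}` is written `(Φ 0, Φ 1)`. -/
def pairBimap {k : Type*} [Field k] {ι : Type*} [Fintype ι]
    (Φ : Fin 2 → Matrix ι ι k) (u v : ι → k) : Fin 2 → k :=
  fun i => u ⬝ᵥ (Φ i *ᵥ v)

/-- Both matrices of the pair are alternating: `u Φᵢ uᵗ = 0` for all `u`. -/
def IsAltPair {k : Type*} [Field k] {ι : Type*} [Fintype ι]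
    (Φ : Fin 2 → Matrix ι ι k) : Prop :=
  ∀ u : ι → k, pairBimap Φ u u = 0

/-- Orthogonally indecomposable pair: the space is nonzero and is not the direct sum of two nonzero
subspaces that are orthogonal with respect to both forms. -/
def IsIndecPair {k : Type*} [Field k] {ι : Type*} [Fintype ι]
    (Φ : Fin 2 → Matrix ι ι k) : Prop :=
  Nonempty ι ∧ ∀ U W : Submodule k (ι → k), IsCompl U W →
    (∀ u ∈ U, ∀ w ∈ W, pairBimap Φ u w = 0 ∧ pairBimap Φ w u = 0) → U = ⊥ ∨ W = ⊥

/-- Sloped pair: after a change of basis of the target `k²`, the first form is nondegenerate;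
that is, some `k`-linear combination of the two forms is nondegenerate. -/
def IsSlopedPair {k : Type*} [Field k] {ι : Type*} [Fintype ι] [DecidableEq ι]
    (Φ : Fin 2 → Matrix ι ι k) : Prop :=
  ∃ a b : k, (a • Φ 0 + b • Φ 1).det ≠ 0

/-- The block diagonal pair `Φᵢ = diag(Φᵢ⁽¹⁾, …, Φᵢ⁽ˢ⁾)`; the blocks are given by
`Φ j i = Φᵢ⁽ʲ⁾`. -/
def diagPair {k : Type*} [Field k] {s : ℕ} {d : Fin s → ℕ}
    (Φ : ∀ j : Fin s, Fin 2 → Matrix (Fin (d j)) (Fin (d j)) k) :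
    Fin 2 → Matrix (Σ j, Fin (d j)) (Σ j, Fin (d j)) k :=
  fun i => Matrix.blockDiagonal' (fun j => Φ j i)

/-- The generalized discriminant `disc(Ψ₁, Ψ₂) = det(x Ψ₁ + y Ψ₂)` in `k[x, y]`,
where `x = X 0`, `y = X 1`. -/
noncomputable def genDisc {k : Type*} [Field k] {ι : Type*} [Fintype ι] [DecidableEq ι]
    (Ψ : Fin 2 → Matrix ι ι k) : MvPolynomial (Fin 2) k :=
  (∑ i, (MvPolynomial.X i : MvPolynomial (Fin 2) k) • (Ψ i).map MvPolynomial.C).det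

/-- `f` is a generalized Pfaffian of the pair `Φ`: there is a basis of `k^ι`, split as a basis of
`E` followed by a basis of `F`, with `dim E = dim F`, relative to which
`Φᵢ = [0, Ψᵢ; -Ψᵢᵗ, 0]` for `i = 1, 2`, and `f = disc(Ψ₁, Ψ₂)`. -/
def IsGenPfaffian {k : Type*} [Field k] {ι : Type*} [Fintype ι]
    (Φ : Fin 2 → Matrix ι ι k) (f : MvPolynomial (Fin 2) k) : Prop :=
  ∃ (n : ℕ) (b : Module.Basis (Fin n ⊕ Fin n) k (ι → k)) (Ψ : Fin 2 → Matrix (Fin n) (Fin n) k),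
    (∀ i, (Matrix.of fun p q => pairBimap Φ (b p) (b q) i) =
      Matrix.fromBlocks 0 (Ψ i) (-(Ψ i)ᵀ) 0) ∧
    f = genDisc Ψ

/-- Congruence modulo `k^×`: equality up to a nonzero scalar factor. -/
def EqModScalars {k : Type*} [Field k] (f g : MvPolynomial (Fin 2) k) : Prop :=
  ∃ c : k, c ≠ 0 ∧ g = MvPolynomial.C c * f

theorem genDisc_sq {k : Type*} [Field k] {ι : Type*} [Fintype ι] [DecidableEq ι]
    (Φ : Fin 2 → Matrix ι ι k) (n : ℕ) (b : Module.Basis (Fin n ⊕ Fin n) k (ι → k))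
    (Ψ : Fin 2 → Matrix (Fin n) (Fin n) k)
    (h : ∀ i, (Matrix.of fun p q => pairBimap Φ (b p) (b q) i) =
      Matrix.fromBlocks 0 (Ψ i) (-(Ψ i)ᵀ) 0) :
    2 * n = Fintype.card ι ∧ ∃ δ : k, δ ≠ 0 ∧ (genDisc Ψ) ^ 2 *
      (Matrix.J (Fin n) (MvPolynomial (Fin 2) k)).det = MvPolynomial.C δ ^ 2 * genDisc Φ := by
  have hcard : 2 * n = Fintype.card ι := by
    have h1 := Module.finrank_eq_card_basis b
    simp at h1
    omega
  refine ⟨hcard, ?_⟩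
  have e : Fin n ⊕ Fin n ≃ ι := Fintype.equivOfCardEq (by simp; omega)
  let P : Matrix (Fin n ⊕ Fin n) ι k := Matrix.of fun p q => b p q
  have hgram : ∀ i, P * Φ i * Pᵀ = Matrix.fromBlocks 0 (Ψ i) (-(Ψ i)ᵀ) 0 := by
    intro i
    rw [← h i]
    ext p q
    rw [Matrix.mul_assoc]
    simp only [Matrix.mul_apply, Matrix.of_apply, pairBimap, dotProduct, Matrix.mulVec,
      Matrix.transpose_apply, P]
  let Q : Matrix ι ι k := P.submatrix e.symm id
  have hQ : Q.det ≠ 0 := by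
    have hli : LinearIndependent k Q.row := by
      have := b.linearIndependent.comp e.symm e.symm.injective
      exact this
    exact (Matrix.isUnit_iff_isUnit_det Q).1 (Matrix.linearIndependent_rows_iff_isUnit.1 hli)
      |>.ne_zero
  refine ⟨Q.det, hQ, ?_⟩
  let R : Type _ := MvPolynomial (Fin 2) k
  let A : Matrix (Fin n) (Fin n) R :=
    ∑ i, (MvPolynomial.X i : R) • (Ψ i).map MvPolynomial.C
  let D : Matrix ι ι R := ∑ i, (MvPolynomial.X i : R) • (Φ i).map MvPolynomial.C
  let PC : Matrix (Fin n ⊕ Fin n) ι R := P.map MvPolynomial.C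
  have h1 : PC * D * PCᵀ = Matrix.fromBlocks 0 A (-Aᵀ) 0 := by
    have h2 : ∀ i, PC * (Φ i).map (MvPolynomial.C : k →+* R) * PCᵀ =
        Matrix.fromBlocks 0 ((Ψ i).map (MvPolynomial.C : k →+* R))
          (-((Ψ i).map (MvPolynomial.C : k →+* R))ᵀ) 0 := by
      intro i
      have := congrArg (fun M => M.map (MvPolynomial.C : k →+* R)) (hgram i)
      simp only [Matrix.map_mul, Matrix.fromBlocks_map] at this
      rw [← Matrix.transpose_map, this]
      congr 1 <;> ext <;> simp
    simp only [D, A, Fin.sum_univ_two, Matrix.mul_add, Matrix.add_mul, Matrix.mul_smul,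
      Matrix.smul_mul, h2, Matrix.fromBlocks_smul, Matrix.fromBlocks_add]
    congr 1 <;> simp [add_comm]
  have h3 : (Matrix.fromBlocks 0 A (-Aᵀ) 0).det * (Matrix.J (Fin n) R).det = A.det ^ 2 := by
    rw [← Matrix.det_mul, Matrix.J, Matrix.fromBlocks_multiply]
    simp [sq]
    left
    rw [neg_neg, Matrix.det_transpose]
  have h4 : (PC * D * PCᵀ).det = MvPolynomial.C Q.det ^ 2 * D.det := by
    have h5 : (PC * D * PCᵀ).submatrix e.symm e.symm =
        (Q.map MvPolynomial.C) * D * (Q.map MvPolynomial.C)ᵀ := rfl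
    rw [← Matrix.det_submatrix_equiv_self e.symm, h5, Matrix.det_mul, Matrix.det_mul,
      Matrix.det_transpose, RingHom.map_det]
    simp only [RingHom.mapMatrix_apply]
    ring
  have hJJ := Matrix.J_det_mul_J_det (Fin n) R
  rw [h1] at h4
  change A.det ^ 2 * (Matrix.J (Fin n) R).det = MvPolynomial.C Q.det ^ 2 * D.det
  rw [← h4, ← h3, mul_assoc, hJJ, mul_one]

/-- The generalized Pfaffian does not depend, up to nonzero scalars, on the choice of the
decomposition and of the bases. -/
theorem IsGenPfaffian.unique {k : Type*} [Field k] {ι : Type*} [Fintype ι]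
    {Φ : Fin 2 → Matrix ι ι k} {f g : MvPolynomial (Fin 2) k}
    (hf : IsGenPfaffian Φ f) (hg : IsGenPfaffian Φ g) : EqModScalars f g := by
  classical
  obtain ⟨n, b, Ψ, h, rfl⟩ := hf
  obtain ⟨m, b', Ψ', h', rfl⟩ := hg
  obtain ⟨hn, δ, hδ, e⟩ := genDisc_sq Φ n b Ψ h
  obtain ⟨hm, δ', hδ', e'⟩ := genDisc_sq Φ m b' Ψ' h'
  obtain rfl : n = m := by omega
  have hJ : (Matrix.J (Fin n) (MvPolynomial (Fin 2) k)).det ≠ 0 :=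
    (Matrix.isUnit_det_J (Fin n) _).ne_zero
  have key : (MvPolynomial.C δ * genDisc Ψ') ^ 2 = (MvPolynomial.C δ' * genDisc Ψ) ^ 2 := by
    apply mul_right_cancel₀ hJ
    linear_combination MvPolynomial.C δ ^ 2 * e' - MvPolynomial.C δ' ^ 2 * e
  have hC : (MvPolynomial.C δ⁻¹ * MvPolynomial.C δ : MvPolynomial (Fin 2) k) = 1 := by
    rw [← map_mul, inv_mul_cancel₀ hδ, map_one]
  rcases sq_eq_sq_iff_eq_or_eq_neg.1 key with h1 | h1
  · refine ⟨δ⁻¹ * δ', mul_ne_zero (inv_ne_zero hδ) hδ', ?_⟩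
    rw [map_mul]
    linear_combination MvPolynomial.C δ⁻¹ * h1 - genDisc Ψ' * hC
  · refine ⟨-(δ⁻¹ * δ'), neg_ne_zero.2 (mul_ne_zero (inv_ne_zero hδ) hδ'), ?_⟩
    rw [map_neg, map_mul]
    linear_combination MvPolynomial.C δ⁻¹ * h1 - genDisc Ψ' * hC

/-- An element `(M, τ)` of `ΓL(2, k) = GL(2, k) ⋊ Gal(k)`, where `Gal(k)` is the group of all
field automorphisms of `k`. -/
structure GammaL2 (k : Type*) [Field k] where
  /-- the matrix `[a, b; c, d]` -/
  mat : GL (Fin 2) k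
  /-- the field automorphism -/
  aut : k ≃+* k

/-- The semilinear action of `ΓL(2, k)` on row vectors: `w ↦ w^τ M`. -/
def GammaL2.act {k : Type*} [Field k] (A : GammaL2 k) (w : Fin 2 → k) : Fin 2 → k :=
  (fun i => A.aut (w i)) ᵥ* (A.mat : Matrix (Fin 2) (Fin 2) k)

/-- The action on polynomials: `f ↦ f^τ(a x + b y, c x + d y)`, where `f^τ` is obtained by applying
`τ` to the coefficients. -/
noncomputable def GammaL2.polyAct {k : Type*} [Field k] (A : GammaL2 k)
    (f : MvPolynomial (Fin 2) k) : MvPolynomial (Fin 2) k :=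
  MvPolynomial.bind₁
    (fun i => MvPolynomial.C ((A.mat : Matrix (Fin 2) (Fin 2) k) i 0) * MvPolynomial.X 0 +
      MvPolynomial.C ((A.mat : Matrix (Fin 2) (Fin 2) k) i 1) * MvPolynomial.X 1)
    (MvPolynomial.map (A.aut : k →+* k) f)

/-- `(α, A)` is a pseudo-isometry from the bimap of `Φ` to the bimap of `Λ` for some bijective
semilinear map `α` (an element of `ΓL(d, k)` when both spaces are `k^d`): one has `(uα) • (vα) = (u ∘ v)A` for all `u`, `v`. -/
def LiftsToPseudoIsometry {k : Type*} [Field k] {ι κ : Type*} [Fintype ι] [Fintype κ]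
    (A : GammaL2 k) (Φ : Fin 2 → Matrix ι ι k) (Λ : Fin 2 → Matrix κ κ k) : Prop :=
  ∃ (ρ : k ≃+* k) (α : (ι → k) →ₛₗ[(ρ : k →+* k)] (κ → k)),
    Function.Bijective α ∧ ∀ u v, pairBimap Λ (α u) (α v) = A.act (pairBimap Φ u v)

/-!
A pseudo-isometry over `α̂` is an isometry from the pair twisted by `α̂`, so the question is when
two orthogonal sums of indecomposable sloped pairs (*blocks*) are isometric.

After a change of coordinates in `k²` the first form of a block is nondegenerate, and the block is
then determined by a self-adjoint operator, its slope. Indecomposability forces the block to be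
isometric to `(k[x]/(pⁿ))²` with the forms `φ(xⁱ det(u, v))`, `i = 0, 1`, where `p` is irreducible
and `φ` is the top coefficient. Its generalized Pfaffian is, up to the change of coordinates, the
homogenization of `pⁿ`, so the Pfaffian determines the block up to isometry.

That the blocks of an orthogonal sum are unique follows from a count of dimensions. The pairs of
adjoint maps between two blocks form a space of dimension `0` if their polynomials `p` differ and
twice the smaller of the dimensions of the two blocks otherwise, also over finite fields, since any
two blocks admit a common nondegenerate combination. These dimensions are additive over orthogonal
sums, and `min (n, m)` is the cardinality of an intersection of initial segments, which makes the
form they define positive definite.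
-/

/-- A pair of bilinear forms on the same module; it represents the bimap `V × V → R²`,
`(u, v) ↦ (B 0 u v, B 1 u v)`. -/
abbrev FormPair (R V : Type*) [CommRing R] [AddCommGroup V] [Module R V] :=
  Fin 2 → LinearMap.BilinForm R V

namespace FormPair

/-! ### Isometries, changes of the target, adjoint pairs and orthogonal sums -/

section Basic

variable {R : Type*} [CommRing R] {V V' V'' : Type*} [AddCommGroup V] [Module R V]
  [AddCommGroup V'] [Module R V'] [AddCommGroup V''] [Module R V'']
  {B : FormPair R V} {B' : FormPair R V'} {B'' : FormPair R V''}

/-- Both forms are alternating. -/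
def IsAlt (B : FormPair R V) : Prop := ∀ i, (B i).IsAlt

/-- Isometry of pairs: a linear isomorphism preserves both forms. -/
def Isometric (B : FormPair R V) (B' : FormPair R V') : Prop :=
  ∃ e : V ≃ₗ[R] V', ∀ i u v, B' i (e u) (e v) = B i u v

/-- Orthogonal indecomposability: the module is nonzero and is not the direct sum of two nonzero
submodules orthogonal for both forms. Only one order of the arguments is required to vanish, as
this notion is used for alternating pairs. -/
def IsIndec (B : FormPair R V) : Prop :=
  Nontrivial V ∧ ∀ U W : Submodule R V, IsCompl U W →
    (∀ u ∈ U, ∀ w ∈ W, ∀ i, B i u w = 0) → U = ⊥ ∨ W = ⊥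

/-- The pair obtained by a linear change of coordinates in the target `R²`. -/
def combo (g : GL (Fin 2) R) (B : FormPair R V) : FormPair R V :=
  fun i => ∑ j, g i j • B j

/-- The pairs `(P, Q)` of linear maps `P : V → V'`, `Q : V' → V` that are adjoint for both
forms. -/
def adjointPairs (B : FormPair R V) (B' : FormPair R V') :
    Submodule R ((V →ₗ[R] V') × (V' →ₗ[R] V)) where
  carrier := {X | ∀ i, LinearMap.IsAdjointPair (B i) (B' i) X.1 X.2}
  zero_mem' _ := LinearMap.isAdjointPair_zero
  add_mem' hX hY i := (hX i).add (hY i)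
  smul_mem' c _ hX i := (hX i).smul c

/-- The orthogonal sum of a finite family of pairs. -/
def orthSum {J : Type*} [Fintype J] {V : J → Type*} [∀ j, AddCommGroup (V j)]
    [∀ j, Module R (V j)] (B : ∀ j, FormPair R (V j)) : FormPair R (∀ j, V j) :=
  fun i => ∑ j, (B j i).compl₁₂ (LinearMap.proj j) (LinearMap.proj j)

theorem mem_adjointPairs {X : (V →ₗ[R] V') × (V' →ₗ[R] V)} :
    X ∈ adjointPairs B B' ↔ ∀ i u w, B' i (X.1 u) w = B i u (X.2 w) := Iff.rfl

theorem combo_apply (g : GL (Fin 2) R) (B : FormPair R V) (i : Fin 2) (u v : V) :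
    combo g B i u v = ∑ j, g i j * B j u v := by
  simp [combo]

theorem combo_mul (g h : GL (Fin 2) R) (B : FormPair R V) :
    combo (g * h) B = combo g (combo h B) := by
  ext i u v
  simp only [combo_apply, Units.val_mul, Matrix.mul_apply, Finset.mul_sum, Finset.sum_mul,
    mul_assoc]
  exact Finset.sum_comm

theorem combo_one (B : FormPair R V) : combo 1 B = B := by
  ext i u v
  simp [combo_apply, Matrix.one_apply]

@[simp]
theorem combo_inv_combo (g : GL (Fin 2) R) (B : FormPair R V) : combo g⁻¹ (combo g B) = B := by
  rw [← combo_mul, inv_mul_cancel, combo_one]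

theorem Isometric.refl (B : FormPair R V) : Isometric B B :=
  ⟨LinearEquiv.refl R V, fun _ _ _ => rfl⟩

theorem Isometric.symm (h : Isometric B B') : Isometric B' B := by
  obtain ⟨e, he⟩ := h
  exact ⟨e.symm, fun i u v => by simpa using (he i (e.symm u) (e.symm v)).symm⟩

theorem Isometric.trans (h : Isometric B B') (h' : Isometric B' B'') : Isometric B B'' := by
  obtain ⟨e, he⟩ := h
  obtain ⟨e', he'⟩ := h'
  exact ⟨e.trans e', fun i u v => by simp only [LinearEquiv.trans_apply, he, he']⟩

theorem isometric_combo_iff (g : GL (Fin 2) R) :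
    Isometric (combo g B) (combo g B') ↔ Isometric B B' := by
  have combo_of_isometric (g : GL (Fin 2) R) {B : FormPair R V} {B' : FormPair R V'} :
      Isometric B B' → Isometric (combo g B) (combo g B') := fun ⟨e, he⟩ =>
    ⟨e, fun i u v => by simp only [combo_apply, he]⟩
  refine ⟨fun h => ?_, combo_of_isometric g⟩
  simpa only [combo_inv_combo] using combo_of_isometric g⁻¹ h

theorem IsAlt.eq_neg (h : IsAlt B) (i : Fin 2) (u v : V) : B i u v = -B i v u :=
  ((h i).neg_eq v u).symm

theorem IsAlt.combo (h : IsAlt B) (g : GL (Fin 2) R) : IsAlt (combo g B) := fun i u => by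
  simp only [combo_apply, h _ u, mul_zero, Finset.sum_const_zero]

theorem IsIndec.combo (h : IsIndec B) (g : GL (Fin 2) R) : IsIndec (combo g B) := by
  refine ⟨h.1, fun U W hUW ho => h.2 U W hUW fun u hu w hw i => ?_⟩
  rw [← combo_inv_combo g B, combo_apply]
  simp only [ho u hu w hw, mul_zero, Finset.sum_const_zero]

theorem adjointPairs_combo (g : GL (Fin 2) R) (B : FormPair R V) (B' : FormPair R V') :
    adjointPairs (combo g B) (combo g B') = adjointPairs B B' := by
  have le_combo (g : GL (Fin 2) R) (B : FormPair R V) (B' : FormPair R V') :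
      adjointPairs B B' ≤ adjointPairs (combo g B) (combo g B') := fun X hX i u w => by
    simp only [combo_apply, hX _ u w]
  refine le_antisymm ?_ (le_combo g B B')
  simpa only [combo_inv_combo] using le_combo g⁻¹ (combo g B) (combo g B')

theorem Isometric.finrank_adjointPairs_eq {W W' : Type*} [AddCommGroup W] [Module R W]
    [AddCommGroup W'] [Module R W'] {C : FormPair R W} {C' : FormPair R W'} (h : Isometric B C)
    (h' : Isometric B' C') :
    Module.finrank R (adjointPairs B B') = Module.finrank R (adjointPairs C C') := by
  obtain ⟨e, he⟩ := h
  obtain ⟨e', he'⟩ := h'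
  refine (LinearEquiv.ofSubmodules ((e.arrowCongr e').prodCongr (e'.arrowCongr e)) _ _
    ?_).finrank_eq
  ext X
  rw [Submodule.map_equiv_eq_comap_symm, Submodule.mem_comap, mem_adjointPairs, mem_adjointPairs]
  refine forall_congr' fun i => ⟨fun hX u w => ?_, fun hX u w => ?_⟩
  · simpa [← he, ← he'] using hX (e.symm u) (e'.symm w)
  · simpa [← he, ← he'] using hX (e u) (e' w)

theorem finrank_adjointPairs_comm (h : IsAlt B) (h' : IsAlt B') :
    Module.finrank R (adjointPairs B B') = Module.finrank R (adjointPairs B' B) := by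
  refine (LinearEquiv.ofSubmodules (LinearEquiv.prodComm R _ _) _ _ ?_).finrank_eq
  ext X
  rw [Submodule.map_equiv_eq_comap_symm, Submodule.mem_comap, mem_adjointPairs, mem_adjointPairs]
  refine forall_congr' fun i => (forall_comm.trans <| forall₂_congr fun w u => ?_)
  rw [h'.eq_neg, h.eq_neg, neg_inj, eq_comm]
  rfl

end Basic

section OrthSum

variable {R : Type*} [CommRing R] {J J' : Type*} [Fintype J] [Fintype J']
  {V : J → Type*} [∀ j, AddCommGroup (V j)] [∀ j, Module R (V j)]
  {V' : J' → Type*} [∀ j, AddCommGroup (V' j)] [∀ j, Module R (V' j)]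

theorem orthSum_apply (B : ∀ j, FormPair R (V j)) (i : Fin 2) (u v : ∀ j, V j) :
    orthSum B i u v = ∑ j, B j i (u j) (v j) := by
  simp [orthSum]

theorem orthSum_single_apply [DecidableEq J] (B : ∀ j, FormPair R (V j)) (i : Fin 2) (j : J)
    (u : V j) (v : ∀ j, V j) : orthSum B i (LinearMap.single R V j u) v = B j i u (v j) := by
  rw [orthSum_apply, Finset.sum_eq_single j (by intro l _ hl; simp [hl]) (by simp)]
  simp

theorem Isometric.orthSum {B : ∀ j, FormPair R (V j)} {B' : ∀ j, FormPair R (V' j)}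
    (σ : J ≃ J') (h : ∀ j, Isometric (B j) (B' (σ j))) :
    Isometric (orthSum B) (orthSum B') := by
  choose e he using h
  refine ⟨(LinearEquiv.piCongrRight e).trans (LinearEquiv.piCongrLeft R V' σ), fun i u v => ?_⟩
  rw [orthSum_apply, orthSum_apply, ← σ.sum_comp]
  refine Finset.sum_congr rfl fun j _ => ?_
  have apply_component (u : ∀ j, V j) :
      (LinearEquiv.piCongrRight e ≪≫ₗ LinearEquiv.piCongrLeft R V' σ) u (σ j) = e j (u j) :=
    Equiv.piCongrLeft_apply_apply V' σ (fun j => e j (u j)) j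
  rw [apply_component, apply_component, he]

/-- Adjoint pairs out of an orthogonal sum are families of adjoint pairs out of the summands. -/
def adjointPairsOrthSumEquiv [DecidableEq J] {W : Type*} [AddCommGroup W] [Module R W]
    (B : ∀ j, FormPair R (V j)) (C : FormPair R W) :
    adjointPairs (orthSum B) C ≃ₗ[R] ∀ j, adjointPairs (B j) C where
  toFun X j := ⟨(X.1.1 ∘ₗ LinearMap.single R V j, LinearMap.proj j ∘ₗ X.1.2), fun i u w =>
    (X.2 i (LinearMap.single R V j u) w).trans (orthSum_single_apply B i j u _)⟩
  map_add' _ _ := rfl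
  map_smul' _ _ := rfl
  invFun Y := ⟨(∑ j, (Y j).1.1 ∘ₗ LinearMap.proj j, LinearMap.pi fun j => (Y j).1.2), by
    intro i u w
    simp only [orthSum_apply, LinearMap.sum_apply, LinearMap.comp_apply, LinearMap.proj_apply,
      map_sum, LinearMap.pi_apply, (Y _).2 i _ w]⟩
  left_inv X := by
    refine Subtype.ext (Prod.ext (LinearMap.ext fun u => ?_) rfl)
    simp only [LinearMap.sum_apply, LinearMap.comp_apply, LinearMap.proj_apply, ← map_sum,
      LinearMap.coe_single, Finset.univ_sum_single]
  right_inv Y := by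
    refine funext fun j => Subtype.ext (Prod.ext (LinearMap.ext fun u => ?_) rfl)
    simp only [LinearMap.sum_apply, LinearMap.comp_apply, LinearMap.proj_apply]
    rw [Finset.sum_eq_single j (by intro l _ hl; simp [hl]) (by simp)]
    simp

end OrthSum

/-! ### The slope operator -/

section Slope

open Polynomial

variable {R : Type*} [CommRing R] {V V' : Type*} [AddCommGroup V] [Module R V]
  [AddCommGroup V'] [Module R V'] {B : FormPair R V} {B' : FormPair R V'}
  {T : Module.End R V} {T' : Module.End R V'}

/-- `T` is a slope of the pair: `B 1 = B 0 ∘ (1 × T)`. It is unique if `B 0` is nondegenerate, and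
then represents the quotient `(B 0)⁻¹ (B 1)`. -/
def IsSlope (B : FormPair R V) (T : Module.End R V) : Prop := ∀ u v, B 0 u (T v) = B 1 u v

theorem IsSlope.apply_eq (hT : IsSlope B T) (i : Fin 2) (u v : V) :
    B i u v = B 0 u ((T ^ (i : ℕ)) v) := by
  fin_cases i
  · rfl
  · simpa using (hT u v).symm

theorem IsSlope.isSelfAdjoint (hT : IsSlope B T) (hB : IsAlt B) : (B 0).IsSelfAdjoint T :=
  fun u v => by rw [hB.eq_neg, hT, hT, ← hB.eq_neg]

theorem IsSlope.isSelfAdjoint_pow (hT : IsSlope B T) (hB : IsAlt B) (n : ℕ) :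
    (B 0).IsSelfAdjoint (T ^ n : Module.End R V) := by
  induction n with
  | zero => exact LinearMap.isAdjointPair_one
  | succ n ih =>
    have h := ih.mul (hT.isSelfAdjoint hB)
    rwa [← pow_succ, ← pow_succ'] at h

theorem IsSlope.isSelfAdjoint_aeval (hT : IsSlope B T) (hB : IsAlt B) (q : R[X]) :
    (B 0).IsSelfAdjoint (aeval T q) := fun u v => by
  simp only [aeval_eq_sum_range, LinearMap.sum_apply, LinearMap.smul_apply, map_sum, map_smul,
    hT.isSelfAdjoint_pow hB _ u v]

theorem IsSlope.apply_pow_self (hT : IsSlope B T) (hB : IsAlt B) (n : ℕ) (u : V) :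
    B 0 u ((T ^ n) u) = 0 := by
  induction n using Nat.twoStepInduction generalizing u with
  | zero => exact hB 0 u
  | one => rw [pow_one, hT]; exact hB 1 u
  | more n ih _ =>
    rw [pow_succ', Module.End.mul_apply, ← hT.isSelfAdjoint hB, pow_succ, Module.End.mul_apply, ih]

theorem IsSlope.apply_aeval_self (hT : IsSlope B T) (hB : IsAlt B) (q : R[X]) (u : V) :
    B 0 u (aeval T q u) = 0 := by
  simp only [aeval_eq_sum_range, LinearMap.sum_apply, LinearMap.smul_apply, map_sum, map_smul,
    hT.apply_pow_self hB, smul_zero, Finset.sum_const_zero]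

theorem IsSlope.apply_aeval_aeval_self (hT : IsSlope B T) (hB : IsAlt B) (q r : R[X]) (u : V) :
    B 0 (aeval T q u) (aeval T r u) = 0 := by
  rw [hT.isSelfAdjoint_aeval hB, ← Module.End.mul_apply, ← map_mul, hT.apply_aeval_self hB]

theorem IsSlope.comp_eq_of_mem_adjointPairs (hT : IsSlope B T) (hB : IsAlt B)
    (hT' : IsSlope B' T') (hB' : IsAlt B') (hnd' : (B' 0).SeparatingLeft)
    {X : (V →ₗ[R] V') × (V' →ₗ[R] V)} (hX : X ∈ adjointPairs B B') :
    X.1 ∘ₗ T = T' ∘ₗ X.1 := by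
  refine LinearMap.ext fun u => sub_eq_zero.1 (hnd' _ fun w => ?_)
  rw [map_sub, LinearMap.sub_apply, LinearMap.comp_apply, LinearMap.comp_apply, hX 0,
    hT.isSelfAdjoint hB, hT, ← hX 1, hT'.isSelfAdjoint hB', hT', sub_self]

theorem IsSlope.map_aeval_of_mem_adjointPairs (hT : IsSlope B T) (hB : IsAlt B)
    (hT' : IsSlope B' T') (hB' : IsAlt B') (hnd' : (B' 0).SeparatingLeft)
    {X : (V →ₗ[R] V') × (V' →ₗ[R] V)} (hX : X ∈ adjointPairs B B') (q : R[X]) (u : V) :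
    X.1 (aeval T q u) = aeval T' q (X.1 u) := by
  have map_slope (u : V) : X.1 (T u) = T' (X.1 u) :=
    LinearMap.congr_fun (hT.comp_eq_of_mem_adjointPairs hB hT' hB' hnd' hX) u
  have map_pow (n : ℕ) (u : V) : X.1 ((T ^ n) u) = (T' ^ n) (X.1 u) := by
    induction n generalizing u with
    | zero => rfl
    | succ n ih => simp only [pow_succ, Module.End.mul_apply, ih, map_slope]
  simp only [aeval_eq_sum_range, LinearMap.sum_apply, LinearMap.smul_apply, map_sum, map_smul,
    map_pow]

theorem eq_zero_of_mem_adjointPairs (hB : IsAlt B) (hnd : (B 0).SeparatingLeft)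
    {X : (V →ₗ[R] V') × (V' →ₗ[R] V)} (hX : X ∈ adjointPairs B B') (h : X.1 = 0) : X = 0 := by
  refine Prod.ext h (LinearMap.ext fun w => hnd _ fun u => ?_)
  rw [hB.eq_neg, ← hX, h, LinearMap.zero_apply, map_zero, LinearMap.zero_apply, neg_zero]

end Slope

section Field

open Polynomial

variable {k : Type*} [Field k] {V V' : Type*} [AddCommGroup V] [Module k V]
  [AddCommGroup V'] [Module k V'] {B : FormPair k V} {B' : FormPair k V'}
  {T : Module.End k V} {T' : Module.End k V'}

theorem exists_apply_eq_of_separatingLeft [FiniteDimensional k V] {b : LinearMap.BilinForm k V}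
    (hb : b.SeparatingLeft) (c : V →ₗ[k] V' →ₗ[k] k) :
    ∃ Q : V' →ₗ[k] V, ∀ u w, b u (Q w) = c u w := by
  have hnd := (LinearMap.BilinForm.Nondegenerate.ofSeparatingLeft hb).flip
  exact ⟨(b.flip.toDual hnd).symm.toLinearMap ∘ₗ c.flip, fun u w =>
    LinearMap.BilinForm.apply_toDual_symm_apply (hB := hnd) (c.flip w) u⟩

theorem exists_isSlope [FiniteDimensional k V] (hnd : (B 0).SeparatingLeft) :
    ∃ T, IsSlope B T :=
  exists_apply_eq_of_separatingLeft hnd (B 1)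

theorem IsSlope.exists_mem_adjointPairs [FiniteDimensional k V] (hT : IsSlope B T) (hB : IsAlt B)
    (hnd : (B 0).SeparatingLeft) (hT' : IsSlope B' T') (hB' : IsAlt B') {P : V →ₗ[k] V'}
    (hP : P ∘ₗ T = T' ∘ₗ P) : ∃ Q, (P, Q) ∈ adjointPairs B B' := by
  obtain ⟨Q, hQ⟩ := exists_apply_eq_of_separatingLeft hnd (B' 0 ∘ₗ P)
  refine ⟨Q, fun i u w => ?_⟩
  fin_cases i
  · exact (hQ u w).symm
  · change B' 1 (P u) w = B 1 u (Q w)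
    rw [← hT, ← hT', ← hT'.isSelfAdjoint hB', ← hT.isSelfAdjoint hB, hQ]
    exact congrArg (B' 0 · w) (LinearMap.congr_fun hP u).symm

end Field

/-! ### Model pairs -/

section Model

open Polynomial

variable {R : Type*} [CommRing R] {A : Type*} [CommRing A] [Algebra R A]

/-- The alternating forms `(u, v) ↦ φ (xⁱ det(u, v))`, `i = 0, 1`, on the square of an algebra. -/
def detPair (φ : A →ₗ[R] R) (x : A) : FormPair R (A × A) := fun i =>
  ((LinearMap.mul R A).compl₁₂ (LinearMap.fst R A A) (LinearMap.snd R A A) -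
    (LinearMap.mul R A).compl₁₂ (LinearMap.snd R A A) (LinearMap.fst R A A)).compr₂
      (φ ∘ₗ LinearMap.mulLeft R (x ^ (i : ℕ)))

theorem detPair_apply (φ : A →ₗ[R] R) (x : A) (i : Fin 2) (u v : A × A) :
    detPair φ x i u v = φ (x ^ (i : ℕ) * (u.1 * v.2 - u.2 * v.1)) := rfl

theorem isAlt_detPair (φ : A →ₗ[R] R) (x : A) : IsAlt (detPair φ x) := fun i u => by
  rw [detPair_apply, mul_comm u.2, sub_self, mul_zero, map_zero]

theorem isSlope_detPair (φ : A →ₗ[R] R) (x : A) :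
    IsSlope (detPair φ x) (Algebra.lsmul R R (A × A) x) := fun u v => by
  simp only [detPair_apply, Algebra.lsmul_coe, Prod.smul_fst, Prod.smul_snd, smul_eq_mul,
    Fin.val_zero, Fin.val_one, pow_zero, pow_one]
  congr 1
  ring

theorem separatingLeft_detPair_zero {φ : A →ₗ[R] R} (hφ : ∀ a, a ≠ 0 → ∃ b, φ (a * b) ≠ 0)
    (x : A) : (detPair φ x 0).SeparatingLeft := by
  rintro ⟨a, b⟩ h
  have eq_zero_of_forall (c : A) (hc : ∀ d, φ (c * d) = 0) : c = 0 := by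
    contrapose! hc
    exact hφ c hc
  refine Prod.ext (eq_zero_of_forall _ fun d => ?_) (eq_zero_of_forall _ fun d => ?_)
  · simpa [detPair_apply] using h (0, d)
  · simpa [detPair_apply] using h (d, 0)

/-- The coefficient of the largest power of the root in an element of `R[X]/(μ)`. -/
noncomputable def topCoeff {μ : R[X]} (hμ : μ.Monic) : AdjoinRoot μ →ₗ[R] R :=
  lcoeff R (μ.natDegree - 1) ∘ₗ AdjoinRoot.modByMonicHom hμ

theorem exists_topCoeff_mul_ne_zero {μ : R[X]} (hμ : μ.Monic) (a : AdjoinRoot μ) (ha : a ≠ 0) :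
    ∃ b, topCoeff hμ (a * b) ≠ 0 := by
  set q := AdjoinRoot.modByMonicHom hμ a with hq
  have mk_q : AdjoinRoot.mk μ q = a := AdjoinRoot.mk_leftInverse hμ a
  have q_ne_zero : q ≠ 0 := by
    intro h
    rw [h, map_zero] at mk_q
    exact ha mk_q.symm
  have μ_ne_one : μ ≠ 1 := by
    rintro rfl
    exact ha (by rw [← mk_q, AdjoinRoot.mk_eq_zero]; exact one_dvd _)
  have natDegree_q_lt : q.natDegree < μ.natDegree := by
    obtain ⟨r, rfl⟩ := AdjoinRoot.mk_surjective (g := μ) a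
    rw [hq, AdjoinRoot.modByMonicHom_mk]
    exact natDegree_modByMonic_lt r hμ μ_ne_one
  have : Nontrivial R := nontrivial_iff.1 ⟨q, 0, q_ne_zero⟩
  obtain ⟨n, hn⟩ : ∃ n, μ.natDegree - 1 = q.natDegree + n := Nat.exists_eq_add_of_le (by lia)
  have natDegree_lt : (q * X ^ n).natDegree < μ.natDegree := by
    rw [natDegree_mul_X_pow _ q_ne_zero]
    lia
  refine ⟨AdjoinRoot.mk μ (X ^ n), ?_⟩
  rw [← mk_q, ← map_mul, topCoeff, LinearMap.comp_apply, AdjoinRoot.modByMonicHom_mk,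
    (modByMonic_eq_self_iff hμ).2 (degree_lt_degree natDegree_lt), lcoeff_apply, hn,
    coeff_mul_X_pow]
  exact leadingCoeff_ne_zero.2 q_ne_zero

/-- The pair of alternating forms `(u, v) ↦ λ (xⁱ det(u, v))` on the square of `R[X]/(μ)`, with `x`
the class of `X` and `λ` the top coefficient. Its slope is the multiplication by `x`. -/
noncomputable def model {μ : R[X]} (hμ : μ.Monic) : FormPair R (AdjoinRoot μ × AdjoinRoot μ) :=
  detPair (topCoeff hμ) (AdjoinRoot.root μ)

theorem isAlt_model {μ : R[X]} (hμ : μ.Monic) : IsAlt (model hμ) := isAlt_detPair _ _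

theorem isSlope_model {μ : R[X]} (hμ : μ.Monic) : IsSlope (model hμ)
    (Algebra.lsmul R R (AdjoinRoot μ × AdjoinRoot μ) (AdjoinRoot.root μ)) :=
  isSlope_detPair _ _

theorem separatingLeft_model_zero {μ : R[X]} (hμ : μ.Monic) : (model hμ 0).SeparatingLeft :=
  separatingLeft_detPair_zero (exists_topCoeff_mul_ne_zero hμ) _

theorem model_zero_apply {μ : R[X]} (hμ : μ.Monic) (u v : AdjoinRoot μ × AdjoinRoot μ) :
    model hμ 0 u v = topCoeff hμ (u.1 * v.2 - u.2 * v.1) := by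
  rw [model, detPair_apply, Fin.val_zero, pow_zero, one_mul]

theorem aeval_lsmul_root {M : Type*} {μ : R[X]} [AddCommGroup M] [Module R M]
    [Module (AdjoinRoot μ) M] [IsScalarTower R (AdjoinRoot μ) M] (q : R[X]) (u : M) :
    aeval (Algebra.lsmul R R M (AdjoinRoot.root μ)) q u = AdjoinRoot.mk μ q • u := by
  rw [aeval_algHom_apply, AdjoinRoot.aeval_eq, Algebra.lsmul_coe]

theorem finrank_adjoinRoot_prod [Nontrivial R] {μ : R[X]} (hμ : μ.Monic) :
    Module.finrank R (AdjoinRoot μ × AdjoinRoot μ) = 2 * μ.natDegree := by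
  have := hμ.finite_adjoinRoot
  have := hμ.free_adjoinRoot
  rw [Module.finrank_prod, (AdjoinRoot.powerBasis' hμ).finrank, AdjoinRoot.powerBasis'_dim,
    two_mul]

end Model

/-! ### The structure of indecomposable pairs -/

section Primary

open Polynomial

variable {R : Type*} [CommRing R] {V : Type*} [AddCommGroup V] [Module R V] {B : FormPair R V}
  {T : Module.End R V}

theorem IsSlope.apply_eq_zero_of_isCoprime (hT : IsSlope B T) (hB : IsAlt B) {q r : R[X]}
    (hqr : IsCoprime q r) {u w : V} (hu : aeval T q u = 0) (hw : aeval T r w = 0) (i : Fin 2) :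
    B i u w = 0 := by
  obtain ⟨a, b, hab⟩ := hqr
  have hw' : (T ^ (i : ℕ)) w = aeval T q (aeval T (X ^ (i : ℕ) * a) w) := by
    have h : X ^ (i : ℕ) = q * (X ^ (i : ℕ) * a) + X ^ (i : ℕ) * b * r := by
      linear_combination (-X ^ (i : ℕ) : R[X]) * hab
    rw [← Module.End.mul_apply, ← map_mul]
    have := congrArg (fun s => aeval T s w) h
    simpa [hw] using this
  rw [hT.apply_eq, hw', ← hT.isSelfAdjoint_aeval hB, hu, map_zero, LinearMap.zero_apply]

theorem IsIndec.aeval_eq_zero_or (hind : IsIndec B) (hB : IsAlt B) (hT : IsSlope B T) {q r : R[X]}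
    (hqr : IsCoprime q r) (h : aeval T (q * r) = 0) : aeval T q = 0 ∨ aeval T r = 0 := by
  have hcompl : IsCompl (LinearMap.ker (aeval T q)) (LinearMap.ker (aeval T r)) := by
    refine ⟨disjoint_ker_aeval_of_isCoprime T hqr, codisjoint_iff.2 ?_⟩
    rw [sup_ker_aeval_eq_ker_aeval_mul_of_coprime T hqr, h, LinearMap.ker_zero]
  rw [← LinearMap.ker_eq_top, ← LinearMap.ker_eq_top]
  rcases hind.2 _ _ hcompl fun u hu w hw => hT.apply_eq_zero_of_isCoprime hB hqr hu hw with
    hq | hr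
  · exact .inr (eq_top_of_bot_isCompl (hq ▸ hcompl))
  · exact .inl (eq_top_of_isCompl_bot (hr ▸ hcompl))

end Primary

section Cyclic

open Polynomial

variable {k : Type*} [Field k] {V : Type*} [AddCommGroup V] [Module k V] {B : FormPair k V}
  {T : Module.End k V}

theorem IsIndec.exists_minpoly_eq_pow [FiniteDimensional k V] (hind : IsIndec B) (hB : IsAlt B)
    (hT : IsSlope B T) :
    ∃ (p : k[X]) (n : ℕ), p.Monic ∧ Irreducible p ∧ n ≠ 0 ∧ minpoly k T = p ^ n := by
  have := hind.1
  have hTint : IsIntegral k T := Algebra.IsIntegral.isIntegral T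
  obtain ⟨p, hpm, hp, hdvd⟩ :=
    exists_monic_irreducible_factor (minpoly k T) (minpoly.not_isUnit k T)
  obtain ⟨n, r, hpr, hmin⟩ := WfDvdMonoid.max_power_factor (minpoly.ne_zero hTint) hp
  have hcop : IsCoprime (p ^ n) r := (hp.coprime_iff_not_dvd.2 hpr).pow_left
  refine ⟨p, n, hpm, hp, ?_, ?_⟩
  · rintro rfl
    rw [hmin, pow_zero, one_mul] at hdvd
    exact hpr hdvd
  rcases hind.aeval_eq_zero_or hB hT hcop (by rw [← hmin, minpoly.aeval]) with h | h
  · exact eq_of_monic_of_associated (minpoly.monic hTint) (hpm.pow n)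
      (associated_of_dvd_dvd (minpoly.dvd k T h) ⟨r, hmin⟩)
  · exact absurd (hdvd.trans (minpoly.dvd k T h)) hpr

theorem exists_forall_dvd_of_aeval_eq_zero {p : k[X]} (hp : Irreducible p) {n : ℕ} (hn : n ≠ 0)
    (hT : minpoly k T = p ^ n) : ∃ e, ∀ q, aeval T q e = 0 → p ^ n ∣ q := by
  obtain ⟨e, he⟩ : ∃ e, aeval T (p ^ (n - 1)) e ≠ 0 := by
    by_contra! h
    have hdvd := minpoly.dvd k T (LinearMap.ext h)
    rw [hT, pow_dvd_pow_iff hp.ne_zero hp.not_isUnit] at hdvd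
    lia
  refine ⟨e, fun q hq => ?_⟩
  by_cases hq0 : q = 0
  · exact hq0 ▸ dvd_zero _
  obtain ⟨m, r, hpr, rfl⟩ := WfDvdMonoid.max_power_factor hq0 hp
  by_contra hdvd
  have hmn : m < n := by
    by_contra! h
    exact hdvd ((pow_dvd_pow p h).mul_right r)
  have hzero : aeval T (p ^ m) e = 0 := by
    have hcop : IsCoprime (p ^ n) r := (hp.coprime_iff_not_dvd.2 hpr).pow_left
    refine (Submodule.disjoint_def.1 (disjoint_ker_aeval_of_isCoprime T hcop)) _ ?_ ?_
    · rw [LinearMap.mem_ker, ← hT, minpoly.aeval, LinearMap.zero_apply]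
    · rwa [LinearMap.mem_ker, ← Module.End.mul_apply, ← map_mul, mul_comm]
  apply he
  rw [← Nat.sub_add_cancel (Nat.le_sub_one_of_lt hmn), pow_add, map_mul, Module.End.mul_apply,
    hzero, map_zero]

theorem IsIndec.eq_top_of_restrict_nondegenerate [FiniteDimensional k V] (hind : IsIndec B)
    (hB : IsAlt B) (hT : IsSlope B T) {U : Submodule k V} (hU : U ≠ ⊥)
    (hTU : ∀ u ∈ U, T u ∈ U) (hnd : ((B 0).restrict U).Nondegenerate) : U = ⊤ := by
  have hcompl := LinearMap.BilinForm.isCompl_orthogonal_of_restrict_nondegenerate (hB 0).isRefl hnd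
  have horth : ∀ u ∈ U, ∀ w ∈ (B 0).orthogonal U, ∀ i, B i u w = 0 := by
    intro u hu w hw i
    fin_cases i
    · exact hw u hu
    · exact (hT u w).symm.trans ((hT.isSelfAdjoint hB u w).symm.trans (hw _ (hTU u hu)))
  exact eq_top_of_isCompl_bot (((hind.2 _ _ hcompl horth).resolve_left hU) ▸ hcompl)

theorem IsIndec.isometric_of_isometric_linearMap [FiniteDimensional k V] {W : Type*}
    [AddCommGroup W] [Module k W] [Nontrivial W] {C : FormPair k W} {S : Module.End k W}
    (hind : IsIndec B) (hB : IsAlt B) (hT : IsSlope B T) (hC : (C 0).SeparatingLeft)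
    {Ω : W →ₗ[k] V} (hΩ : ∀ i u v, B i (Ω u) (Ω v) = C i u v) (hTΩ : ∀ u, T (Ω u) = Ω (S u)) :
    Isometric B C := by
  have injective_Ω : Function.Injective Ω := by
    refine (injective_iff_map_eq_zero Ω).2 fun u hu => hC u fun v => ?_
    rw [← hΩ, hu, map_zero, LinearMap.zero_apply]
  have range_eq_top : LinearMap.range Ω = ⊤ := by
    refine hind.eq_top_of_restrict_nondegenerate hB hT ?_ ?_ (.ofSeparatingLeft ?_)
    · obtain ⟨w, hw⟩ := exists_ne (0 : W)
      exact fun h => hw (injective_Ω (by simp [LinearMap.range_eq_bot.1 h]))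
    · rintro _ ⟨u, rfl⟩
      exact ⟨S u, (hTΩ u).symm⟩
    · rintro ⟨_, u, rfl⟩ hu
      have : u = 0 := hC u fun v => (hΩ 0 u v).symm.trans (hu ⟨Ω v, v, rfl⟩)
      simp [this]
  exact .symm ⟨.ofBijective Ω ⟨injective_Ω, LinearMap.range_eq_top.1 range_eq_top⟩, hΩ⟩

end Cyclic

section Hyperbolic

open Polynomial

variable {R : Type*} [CommRing R] {V : Type*} [AddCommGroup V] [Module R V] {B : FormPair R V}
  {T : Module.End R V} {μ : R[X]}

/-- The action of `R[X]/(μ)` on `V` in which `X` acts as `T`. -/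
noncomputable def adjoinRootAction (h : aeval T μ = 0) : AdjoinRoot μ →ₐ[R] Module.End R V :=
  Ideal.Quotient.liftₐ (Ideal.span {μ}) (aeval T) fun q hq => by
    obtain ⟨r, rfl⟩ := Ideal.mem_span_singleton.1 hq
    rw [map_mul, h, zero_mul]

theorem adjoinRootAction_mk (h : aeval T μ = 0) (q : R[X]) :
    adjoinRootAction h (AdjoinRoot.mk μ q) = aeval T q := rfl

/-- The map `(a, b) ↦ a e + b f` for the action of `R[X]/(μ)` through `T`. -/
noncomputable def hyperbolicMap (h : aeval T μ = 0) (e f : V) :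
    AdjoinRoot μ × AdjoinRoot μ →ₗ[R] V :=
  (LinearMap.applyₗ e ∘ₗ (adjoinRootAction h).toLinearMap).coprod
    (LinearMap.applyₗ f ∘ₗ (adjoinRootAction h).toLinearMap)

theorem hyperbolicMap_apply (h : aeval T μ = 0) (e f : V) (u : AdjoinRoot μ × AdjoinRoot μ) :
    hyperbolicMap h e f u = adjoinRootAction h u.1 e + adjoinRootAction h u.2 f := rfl

theorem apply_hyperbolicMap (h : aeval T μ = 0) (e f : V) (u : AdjoinRoot μ × AdjoinRoot μ) :
    T (hyperbolicMap h e f u) = hyperbolicMap h e f (AdjoinRoot.root μ • u) := by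
  have root_eq : adjoinRootAction h (AdjoinRoot.root μ) = T := by
    rw [← AdjoinRoot.mk_X, adjoinRootAction_mk, aeval_X]
  simp only [hyperbolicMap_apply, map_add, Prod.smul_fst, Prod.smul_snd, smul_eq_mul, map_mul,
    root_eq, Module.End.mul_apply]

theorem IsSlope.apply_hyperbolicMap_hyperbolicMap (hT : IsSlope B T) (hB : IsAlt B)
    (hμ : μ.Monic) (h : aeval T μ = 0) {e f : V}
    (hef : ∀ a, B 0 (adjoinRootAction h a e) f = topCoeff hμ a) (i : Fin 2)
    (u v : AdjoinRoot μ × AdjoinRoot μ) :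
    B i (hyperbolicMap h e f u) (hyperbolicMap h e f v) = model hμ i u v := by
  have apply_zero (u v : AdjoinRoot μ × AdjoinRoot μ) :
      B 0 (hyperbolicMap h e f u) (hyperbolicMap h e f v) = model hμ 0 u v := by
    obtain ⟨a, b⟩ := u
    obtain ⟨c, d⟩ := v
    have apply_self (a c : AdjoinRoot μ) (w : V) :
        B 0 (adjoinRootAction h a w) (adjoinRootAction h c w) = 0 := by
      obtain ⟨a, rfl⟩ := AdjoinRoot.mk_surjective a
      obtain ⟨c, rfl⟩ := AdjoinRoot.mk_surjective c
      simp only [adjoinRootAction_mk, hT.apply_aeval_aeval_self hB]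
    have apply_e_f (a d : AdjoinRoot μ) :
        B 0 (adjoinRootAction h a e) (adjoinRootAction h d f) = topCoeff hμ (a * d) := by
      obtain ⟨d, rfl⟩ := AdjoinRoot.mk_surjective d
      rw [adjoinRootAction_mk, ← hT.isSelfAdjoint_aeval hB, ← adjoinRootAction_mk h,
        ← Module.End.mul_apply, ← map_mul, hef, mul_comm]
    simp only [hyperbolicMap_apply, map_add, LinearMap.add_apply, apply_self, apply_e_f,
      hB.eq_neg 0 (adjoinRootAction h b f), model_zero_apply, map_sub, mul_comm b]
    ring
  fin_cases i
  · exact apply_zero u v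
  · change B 1 _ _ = model hμ 1 u v
    rw [← hT, apply_hyperbolicMap, apply_zero, ← isSlope_model hμ, Algebra.lsmul_coe]

end Hyperbolic

section Classification

open Polynomial

variable {k : Type*} [Field k] {V : Type*} [AddCommGroup V] [Module k V] {B : FormPair k V}

theorem IsIndec.exists_isometric_model [FiniteDimensional k V] (hind : IsIndec B) (hB : IsAlt B)
    (hnd : (B 0).SeparatingLeft) :
    ∃ (p : k[X]) (n : ℕ) (hp : p.Monic), Irreducible p ∧ n ≠ 0 ∧
      Isometric B (model (hp.pow n)) := by
  obtain ⟨T, hT⟩ := exists_isSlope hnd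
  obtain ⟨p, n, hpm, hp, hn, hmin⟩ := hind.exists_minpoly_eq_pow hB hT
  have aeval_pow : aeval T (p ^ n) = 0 := hmin ▸ minpoly.aeval k T
  obtain ⟨e, he⟩ := exists_forall_dvd_of_aeval_eq_zero hp hn hmin
  have ker_eq_bot : LinearMap.ker
      (LinearMap.applyₗ e ∘ₗ (adjoinRootAction aeval_pow).toLinearMap) = ⊥ := by
    refine LinearMap.ker_eq_bot'.2 fun a ha => ?_
    obtain ⟨q, rfl⟩ := AdjoinRoot.mk_surjective a
    exact AdjoinRoot.mk_eq_zero.2 (he q ha)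
  obtain ⟨ψ, hψ⟩ := LinearMap.exists_leftInverse_of_injective _ ker_eq_bot
  obtain ⟨f, hf⟩ : ∃ f, ∀ v, B 0 v f = topCoeff (hpm.pow n) (ψ v) := by
    obtain ⟨Q, hQ⟩ := exists_apply_eq_of_separatingLeft hnd
      ((topCoeff (hpm.pow n) ∘ₗ ψ).smulRight (LinearMap.id : k →ₗ[k] k))
    exact ⟨Q 1, fun v => by simpa using hQ v 1⟩
  have hef (a : AdjoinRoot (p ^ n)) :
      B 0 (adjoinRootAction aeval_pow a e) f = topCoeff (hpm.pow n) a := by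
    rw [hf]
    exact congrArg _ (LinearMap.congr_fun hψ a)
  have : Nontrivial (AdjoinRoot (p ^ n)) :=
    AdjoinRoot.nontrivial _ (degree_pos_of_ne_zero_of_nonunit (hpm.pow n).ne_zero
      fun h => hp.not_isUnit ((isUnit_pow_iff hn).1 h)).ne'
  exact ⟨p, n, hpm, hp, hn, hind.isometric_of_isometric_linearMap hB hT
    (S := Algebra.lsmul k k _ (AdjoinRoot.root (p ^ n)))
    (separatingLeft_model_zero _) (hT.apply_hyperbolicMap_hyperbolicMap hB _ _ hef)
    (apply_hyperbolicMap aeval_pow e f)⟩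

end Classification

/-! ### Adjoint pairs between models -/

section ModelAdjoint

open Polynomial

variable {R : Type*} [CommRing R] {μ μ' : R[X]}

theorem map_mk_smul_of_mem_adjointPairs_model {hμ : μ.Monic} {hμ' : μ'.Monic}
    {X : (AdjoinRoot μ × AdjoinRoot μ →ₗ[R] AdjoinRoot μ' × AdjoinRoot μ') ×
      (AdjoinRoot μ' × AdjoinRoot μ' →ₗ[R] AdjoinRoot μ × AdjoinRoot μ)}
    (hX : X ∈ adjointPairs (model hμ) (model hμ')) (q : R[X]) (u : AdjoinRoot μ × AdjoinRoot μ) :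
    X.1 (AdjoinRoot.mk μ q • u) = AdjoinRoot.mk μ' q • X.1 u := by
  rw [← aeval_lsmul_root, ← aeval_lsmul_root]
  exact (isSlope_model hμ).map_aeval_of_mem_adjointPairs (isAlt_model hμ) (isSlope_model hμ')
    (isAlt_model hμ') (separatingLeft_model_zero hμ') hX q u

theorem adjointPairs_model_eq_bot (hμ : μ.Monic) (hμ' : μ'.Monic) (h : IsCoprime μ μ') :
    adjointPairs (model hμ) (model hμ') = ⊥ := by
  refine (Submodule.eq_bot_iff _).2 fun X hX => ?_
  refine eq_zero_of_mem_adjointPairs (isAlt_model hμ) (separatingLeft_model_zero hμ) hX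
    (LinearMap.ext fun u => ?_)
  obtain ⟨a, b, hab⟩ := h
  have mk_eq_one : AdjoinRoot.mk μ' (a * μ) = 1 := by
    rw [← map_one (AdjoinRoot.mk μ'), ← hab, map_add, map_mul _ b, AdjoinRoot.mk_self, mul_zero,
      add_zero]
  rw [← one_smul (AdjoinRoot μ') (X.1 u), ← mk_eq_one, ← map_mk_smul_of_mem_adjointPairs_model hX,
    map_mul, AdjoinRoot.mk_self, mul_zero, zero_smul, map_zero, LinearMap.zero_apply]

/-- The values of an adjoint pair at the two generators of the model. -/
noncomputable def evalGenerators (hμ : μ.Monic) (hμ' : μ'.Monic) :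
    adjointPairs (model hμ) (model hμ') →ₗ[R]
    (AdjoinRoot μ' × AdjoinRoot μ') × (AdjoinRoot μ' × AdjoinRoot μ') where
  toFun X := (X.1.1 (1, 0), X.1.1 (0, 1))
  map_add' _ _ := rfl
  map_smul' _ _ := rfl

theorem injective_evalGenerators (hμ : μ.Monic) (hμ' : μ'.Monic) :
    Function.Injective (evalGenerators hμ hμ') := by
  refine (injective_iff_map_eq_zero _).2 fun ⟨X, hX⟩ h => ?_
  obtain ⟨h₁, h₂⟩ : X.1 (1, 0) = 0 ∧ X.1 (0, 1) = 0 := Prod.ext_iff.1 h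
  refine Subtype.ext (eq_zero_of_mem_adjointPairs (isAlt_model hμ) (separatingLeft_model_zero hμ)
    hX (LinearMap.ext fun ⟨a, b⟩ => ?_))
  obtain ⟨a, rfl⟩ := AdjoinRoot.mk_surjective a
  obtain ⟨b, rfl⟩ := AdjoinRoot.mk_surjective b
  have eq_generators : (AdjoinRoot.mk μ a, AdjoinRoot.mk μ b) =
      AdjoinRoot.mk μ a • ((1, 0) : AdjoinRoot μ × AdjoinRoot μ) + AdjoinRoot.mk μ b • (0, 1) := by
    simp
  rw [eq_generators, map_add, map_mk_smul_of_mem_adjointPairs_model hX,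
    map_mk_smul_of_mem_adjointPairs_model hX, h₁, h₂, smul_zero, smul_zero, add_zero,
    LinearMap.zero_apply]

end ModelAdjoint

section ModelAdjointField

open Polynomial

variable {k : Type*} [Field k] {μ μ' : k[X]}

theorem surjective_evalGenerators (hμ : μ.Monic) (hμ' : μ'.Monic) (hd : μ' ∣ μ) :
    Function.Surjective (evalGenerators hμ hμ') := by
  rintro ⟨v, w⟩
  have := hμ.finite_adjoinRoot
  let π := AdjoinRoot.algHomOfDvd k μ μ' hd
  let P : AdjoinRoot μ × AdjoinRoot μ →ₗ[k] AdjoinRoot μ' × AdjoinRoot μ' :=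
    (π.toLinearMap.smulRight v).coprod (π.toLinearMap.smulRight w)
  have P_apply (u : AdjoinRoot μ × AdjoinRoot μ) : P u = π u.1 • v + π u.2 • w := rfl
  have P_comp_slope : P ∘ₗ Algebra.lsmul k k _ (AdjoinRoot.root μ) =
      Algebra.lsmul k k _ (AdjoinRoot.root μ') ∘ₗ P := by
    refine LinearMap.ext fun u => ?_
    have map_root : π (AdjoinRoot.root μ) = AdjoinRoot.root μ' :=
      AdjoinRoot.algHomOfDvd_root μ μ' hd
    simp only [LinearMap.comp_apply, Algebra.lsmul_coe, P_apply, Prod.smul_fst, Prod.smul_snd,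
      smul_eq_mul, map_mul, map_root, mul_smul, smul_add]
  obtain ⟨Q, hQ⟩ := (isSlope_model hμ).exists_mem_adjointPairs (isAlt_model hμ)
    (separatingLeft_model_zero hμ) (isSlope_model hμ') (isAlt_model hμ') P_comp_slope
  refine ⟨⟨(P, Q), hQ⟩, Prod.ext ?_ ?_⟩
  · exact (P_apply _).trans (by simp)
  · exact (P_apply _).trans (by simp)

theorem finrank_adjointPairs_model_of_dvd (hμ : μ.Monic) (hμ' : μ'.Monic) (hd : μ' ∣ μ) :
    Module.finrank k (adjointPairs (model hμ) (model hμ')) =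
      2 * Module.finrank k (AdjoinRoot μ' × AdjoinRoot μ') := by
  have := hμ'.finite_adjoinRoot
  rw [(LinearEquiv.ofBijective _ ⟨injective_evalGenerators hμ hμ',
    surjective_evalGenerators hμ hμ' hd⟩).finrank_eq, Module.finrank_prod, two_mul]

end ModelAdjointField

/-! ### Elementary divisors -/

section ElementaryDivisor

open Polynomial

variable {k : Type*} [Field k] {V V' : Type*} [AddCommGroup V] [Module k V]
  [AddCommGroup V'] [Module k V'] {B : FormPair k V} {B' : FormPair k V'} {p q : k[X]} {m n : ℕ}

/-- The pair is isometric to the model of `p ^ n`, with `p` monic irreducible: its slope has the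
single elementary divisor `p ^ n`, with multiplicity two. -/
def HasElementaryDivisor (B : FormPair k V) (p : k[X]) (n : ℕ) : Prop :=
  Irreducible p ∧ n ≠ 0 ∧ ∃ hp : p.Monic, Isometric B (model (hp.pow n))

theorem HasElementaryDivisor.finrank_eq (h : HasElementaryDivisor B p n) :
    Module.finrank k V = 2 * (n * p.natDegree) := by
  obtain ⟨-, -, hp, e, -⟩ := h
  rw [e.finrank_eq, finrank_adjoinRoot_prod (hp.pow n), natDegree_pow]

theorem HasElementaryDivisor.finrank_adjointPairs [DecidableEq k[X]]
    (h : HasElementaryDivisor B p n) (h' : HasElementaryDivisor B' q m) :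
    Module.finrank k (adjointPairs B B') =
      if p = q then 2 * min (Module.finrank k V) (Module.finrank k V') else 0 := by
  obtain ⟨hp_irr, -, hp, hB⟩ := id h
  obtain ⟨hq_irr, -, hq, hB'⟩ := id h'
  rw [hB.finrank_adjointPairs_eq hB']
  split_ifs with hpq
  · subst hpq
    rw [h.finrank_eq, h'.finrank_eq]
    rcases le_total m n with hmn | hnm
    · rw [finrank_adjointPairs_model_of_dvd _ _ (pow_dvd_pow p hmn),
        finrank_adjoinRoot_prod (hp.pow m), natDegree_pow, min_eq_right (by gcongr)]
    · rw [finrank_adjointPairs_comm (isAlt_model _) (isAlt_model _),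
        finrank_adjointPairs_model_of_dvd _ _ (pow_dvd_pow p hnm),
        finrank_adjoinRoot_prod (hp.pow n), natDegree_pow, min_eq_left (by gcongr)]
  · have hcop : IsCoprime p q := hp_irr.coprime_iff_not_dvd.2 fun hd =>
      hpq (eq_of_monic_of_associated hp hq (hp_irr.associated_of_dvd hq_irr hd))
    rw [adjointPairs_model_eq_bot _ _ hcop.pow, finrank_bot]

theorem HasElementaryDivisor.isometric (h : HasElementaryDivisor B p n)
    (h' : HasElementaryDivisor B' p m) (hdim : Module.finrank k V = Module.finrank k V') :
    Isometric B B' := by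
  obtain rfl : n = m := by
    rw [h.finrank_eq, h'.finrank_eq] at hdim
    exact Nat.eq_of_mul_eq_mul_right h.1.natDegree_pos (Nat.eq_of_mul_eq_mul_left two_pos hdim)
  obtain ⟨-, -, _, hB⟩ := h
  obtain ⟨-, -, _, hB'⟩ := h'
  exact hB.trans hB'.symm

end ElementaryDivisor

/-! ### Blocks and links between them -/

section NondegenerateAt

open Polynomial

variable {k : Type*} [Field k] {V V' : Type*} [AddCommGroup V] [Module k V]
  [AddCommGroup V'] [Module k V'] {B : FormPair k V} {B' : FormPair k V'} {p : k[X]} {n : ℕ}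

/-- The linear combination of the two forms with coefficients `c` is nondegenerate. -/
def NondegenerateAt (B : FormPair k V) (c : Fin 2 → k) : Prop :=
  (∑ i, c i • B i).SeparatingLeft

theorem nondegenerateAt_combo_iff (g : GL (Fin 2) k) (c : Fin 2 → k) :
    NondegenerateAt (combo g B) c ↔ NondegenerateAt B (c ᵥ* (g : Matrix (Fin 2) (Fin 2) k)) := by
  have : ∑ i, c i • combo g B i = ∑ i, (c ᵥ* (g : Matrix (Fin 2) (Fin 2) k)) i • B i := by
    simp only [combo, Finset.smul_sum, Matrix.vecMul, dotProduct, Finset.sum_smul, mul_smul]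
    exact Finset.sum_comm
  rw [NondegenerateAt, this, NondegenerateAt]

theorem NondegenerateAt.ne_zero [Nontrivial V] {c : Fin 2 → k} (h : NondegenerateAt B c) :
    c ≠ 0 := by
  rintro rfl
  obtain ⟨u, hu⟩ := exists_ne (0 : V)
  exact hu (h u fun v => by simp)

theorem Isometric.nondegenerateAt_iff (h : Isometric B B') (c : Fin 2 → k) :
    NondegenerateAt B c ↔ NondegenerateAt B' c := by
  obtain ⟨e, he⟩ := h
  have : ∑ i, c i • B' i = e.arrowCongr (e.arrowCongr (.refl k k)) (∑ i, c i • B i) := by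
    ext u v
    simp [← he]
  rw [NondegenerateAt, NondegenerateAt, this, LinearMap.separatingLeft_congr_iff]

theorem sum_smul_model_apply {μ : k[X]} (hμ : μ.Monic) (c : Fin 2 → k)
    (u v : AdjoinRoot μ × AdjoinRoot μ) : (∑ i, c i • model hμ i) u v =
      model hμ 0 (AdjoinRoot.mk μ (∑ i, C (c i) * X ^ (i : ℕ)) • u) v := by
  rw [← aeval_lsmul_root, (isSlope_model hμ).isSelfAdjoint_aeval (isAlt_model hμ)]
  simp only [LinearMap.sum_apply, LinearMap.smul_apply, (isSlope_model hμ).apply_eq _ u v, map_sum,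
    ← smul_eq_C_mul, map_smul, map_pow, aeval_X]

theorem nondegenerateAt_model_iff {μ : k[X]} (hμ : μ.Monic) (c : Fin 2 → k) :
    NondegenerateAt (model hμ) c ↔ IsCoprime μ (∑ i, C (c i) * X ^ (i : ℕ)) := by
  have := hμ.finite_adjoinRoot
  set q := ∑ i, C (c i) * X ^ (i : ℕ) with hq
  refine ⟨fun h => ?_, fun ⟨a, b, hab⟩ u hu => ?_⟩
  · have injective_mul : Function.Injective (LinearMap.mulLeft k (AdjoinRoot.mk μ q)) := by
      refine (injective_iff_map_eq_zero _).2 fun a (ha : AdjoinRoot.mk μ q * a = 0) => ?_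
      refine (Prod.ext_iff.1 (h (a, 0) fun v => ?_)).1
      rw [sum_smul_model_apply, ← hq, Prod.smul_mk, smul_eq_mul, ha, smul_zero, Prod.mk_zero_zero,
        map_zero, LinearMap.zero_apply]
    obtain ⟨b, hb⟩ := LinearMap.injective_iff_surjective.1 injective_mul 1
    obtain ⟨b, rfl⟩ := AdjoinRoot.mk_surjective b
    obtain ⟨a, ha⟩ := AdjoinRoot.mk_eq_mk.1 (((AdjoinRoot.mk μ).map_mul q b).trans hb)
    exact ⟨-a, b, by linear_combination ha⟩
  · have smul_eq_zero : AdjoinRoot.mk μ q • u = 0 :=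
      separatingLeft_model_zero hμ _ fun v => by rw [← sum_smul_model_apply, hu]
    have mk_eq_one : AdjoinRoot.mk μ (b * q) = 1 := by
      rw [← map_one (AdjoinRoot.mk μ), ← hab, map_add, map_mul _ a, AdjoinRoot.mk_self, mul_zero,
        zero_add]
    rw [← one_smul (AdjoinRoot μ) u, ← mk_eq_one, map_mul, mul_smul, smul_eq_zero, smul_zero]

theorem HasElementaryDivisor.nondegenerateAt_iff (h : HasElementaryDivisor B p n)
    (c : Fin 2 → k) : NondegenerateAt B c ↔ ¬ p ∣ ∑ i, C (c i) * X ^ (i : ℕ) := by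
  obtain ⟨hp, hn, hpm, hB⟩ := h
  rw [hB.nondegenerateAt_iff, nondegenerateAt_model_iff, IsCoprime.pow_left_iff (by lia),
    hp.coprime_iff_not_dvd]

end NondegenerateAt

section Block

open Polynomial

variable {k : Type*} [Field k] {V V' V'' : Type*} [AddCommGroup V] [Module k V]
  [AddCommGroup V'] [Module k V'] [AddCommGroup V''] [Module k V'']
  {B : FormPair k V} {B' : FormPair k V'} {B'' : FormPair k V''} {g : GL (Fin 2) k}

/-- Indecomposable sloped pairs of alternating forms, the summands of the fully refined orthogonal
decompositions. -/
structure IsBlock (B : FormPair k V) : Prop where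
  isAlt : IsAlt B
  isIndec : IsIndec B
  sloped : ∃ c, NondegenerateAt B c

theorem exists_GL_row_zero_eq {c : Fin 2 → k} (hc : c ≠ 0) :
    ∃ g : GL (Fin 2) k, (g : Matrix (Fin 2) (Fin 2) k) 0 = c := by
  by_cases h : c 0 = 0
  · have h₁ : c 1 ≠ 0 := fun h₁ => hc (funext (Fin.forall_fin_two.2 ⟨h, h₁⟩))
    exact ⟨.mkOfDetNeZero (.of ![c, ![1, 0]]) (by simpa [Matrix.det_fin_two] using h₁), rfl⟩
  · exact ⟨.mkOfDetNeZero (.of ![c, ![0, 1]]) (by simpa [Matrix.det_fin_two] using h), rfl⟩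

theorem IsBlock.exists_hasElementaryDivisor_combo [FiniteDimensional k V] (h : IsBlock B)
    (hg : NondegenerateAt B ((g : Matrix (Fin 2) (Fin 2) k) 0)) :
    ∃ p n, HasElementaryDivisor (combo g B) p n := by
  obtain ⟨p, n, hpm, hp, hn, hiso⟩ :=
    (h.isIndec.combo g).exists_isometric_model (h.isAlt.combo g) hg
  exact ⟨p, n, hp, hn, hpm, hiso⟩

theorem nondegenerateAt_iff_not_dvd {p : k[X]} {n : ℕ} (h : HasElementaryDivisor (combo g B) p n)
    (c : Fin 2 → k) : NondegenerateAt B c ↔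
      ¬ p ∣ ∑ i, C ((c ᵥ* (g⁻¹ : GL (Fin 2) k).1) i) * X ^ (i : ℕ) := by
  rw [← h.nondegenerateAt_iff, nondegenerateAt_combo_iff, Matrix.vecMul_vecMul, ← Units.val_mul,
    inv_mul_cancel, Units.val_one, Matrix.vecMul_one]

theorem IsBlock.exists_degenerate_submodule [FiniteDimensional k V] (h : IsBlock B) :
    ∃ S : Submodule k (Fin 2 → k), ∀ c, c ∈ S ↔ ¬ NondegenerateAt B c := by
  have := h.isIndec.1
  obtain ⟨c, hc⟩ := h.sloped
  obtain ⟨g, rfl⟩ := exists_GL_row_zero_eq hc.ne_zero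
  obtain ⟨p, n, hp⟩ := h.exists_hasElementaryDivisor_combo hc
  let f : (Fin 2 → k) →ₗ[k] k[X] := Fintype.linearCombination k (fun i : Fin 2 => X ^ (i : ℕ)) ∘ₗ
    (g⁻¹ : GL (Fin 2) k).1.vecMulLinear
  refine ⟨((Ideal.span {p}).restrictScalars k).comap f, fun c => ?_⟩
  simp [f, nondegenerateAt_iff_not_dvd hp, Ideal.mem_span_singleton,
    Fintype.linearCombination_apply, smul_eq_C_mul]

/-- A vector space is not the union of two proper subspaces, so two blocks have a common
nondegenerate linear combination. -/
theorem IsBlock.exists_common_nondegenerateAt [FiniteDimensional k V] [FiniteDimensional k V']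
    (h : IsBlock B) (h' : IsBlock B') : ∃ c, NondegenerateAt B c ∧ NondegenerateAt B' c := by
  obtain ⟨S, hS⟩ := h.exists_degenerate_submodule
  obtain ⟨S', hS'⟩ := h'.exists_degenerate_submodule
  obtain ⟨c, hc⟩ := h.sloped
  obtain ⟨c', hc'⟩ := h'.sloped
  by_contra! hcon
  have hcS : c ∉ S := by simpa only [hS, not_not] using hc
  have hcS' : c ∈ S' := by simpa only [hS'] using hcon c hc
  have hc'S' : c' ∉ S' := by simpa only [hS', not_not] using hc'
  have hc'S : c' ∈ S := by
    rw [hS]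
    exact fun h => hcon c' h hc'
  have add_mem : c + c' ∈ S' := by
    rw [hS']
    refine hcon _ (not_not.1 ?_)
    rwa [← hS, S.add_mem_iff_left hc'S]
  exact hc'S' ((S'.add_mem_iff_right hcS').1 add_mem)

theorem IsBlock.exists_common_hasElementaryDivisor [FiniteDimensional k V]
    [FiniteDimensional k V'] (h : IsBlock B) (h' : IsBlock B') :
    ∃ g p n q m, HasElementaryDivisor (combo g B) p n ∧ HasElementaryDivisor (combo g B') q m := by
  have := h.isIndec.1
  obtain ⟨c, hc, hc'⟩ := h.exists_common_nondegenerateAt h'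
  obtain ⟨g, rfl⟩ := exists_GL_row_zero_eq hc.ne_zero
  obtain ⟨p, n, hp⟩ := h.exists_hasElementaryDivisor_combo hc
  obtain ⟨q, m, hq⟩ := h'.exists_hasElementaryDivisor_combo hc'
  exact ⟨g, p, n, q, m, hp, hq⟩

/-- Two pairs are linked if there are nonzero adjoint pairs of maps between them. For blocks this
means that their elementary divisors are powers of the same polynomial. -/
def Linked (B : FormPair k V) (B' : FormPair k V') : Prop :=
  Module.finrank k (adjointPairs B B') ≠ 0

theorem linked_iff [Nontrivial V] [Nontrivial V'] [FiniteDimensional k V]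
    [FiniteDimensional k V'] {p q : k[X]} {n m : ℕ} (h : HasElementaryDivisor (combo g B) p n)
    (h' : HasElementaryDivisor (combo g B') q m) : Linked B B' ↔ p = q := by
  classical
  have : 0 < Module.finrank k V := Module.finrank_pos
  have : 0 < Module.finrank k V' := Module.finrank_pos
  rw [Linked, ← adjointPairs_combo g, h.finrank_adjointPairs h']
  split_ifs with hpq
  · exact iff_of_true (by lia) hpq
  · exact iff_of_false (by simp) hpq

theorem IsBlock.finrank_adjointPairs [FiniteDimensional k V] [FiniteDimensional k V']
    [Decidable (Linked B B')] (h : IsBlock B) (h' : IsBlock B') :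
    Module.finrank k (adjointPairs B B') =
      if Linked B B' then 2 * min (Module.finrank k V) (Module.finrank k V') else 0 := by
  classical
  have := h.isIndec.1
  have := h'.isIndec.1
  obtain ⟨g, p, n, q, m, hp, hq⟩ := h.exists_common_hasElementaryDivisor h'
  rw [← adjointPairs_combo g, hp.finrank_adjointPairs hq]
  exact if_congr (linked_iff hp hq).symm rfl rfl

theorem IsBlock.isometric_of_linked [FiniteDimensional k V] [FiniteDimensional k V']
    (h : IsBlock B) (h' : IsBlock B') (hl : Linked B B')
    (hdim : Module.finrank k V = Module.finrank k V') : Isometric B B' := by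
  have := h.isIndec.1
  have := h'.isIndec.1
  obtain ⟨g, p, n, q, m, hp, hq⟩ := h.exists_common_hasElementaryDivisor h'
  obtain rfl := (linked_iff hp hq).1 hl
  exact (isometric_combo_iff g).1 (hp.isometric hq hdim)

theorem IsBlock.linked_refl [FiniteDimensional k V] (h : IsBlock B) : Linked B B := by
  have := h.isIndec.1
  obtain ⟨g, p, n, -, -, hp, -⟩ := h.exists_common_hasElementaryDivisor h
  exact (linked_iff hp hp).2 rfl

theorem IsBlock.linked_symm (h : IsBlock B) (h' : IsBlock B') (hl : Linked B B') :
    Linked B' B := by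
  rwa [Linked, finrank_adjointPairs_comm h'.isAlt h.isAlt]

theorem IsBlock.nondegenerateAt_of_linked [FiniteDimensional k V] [FiniteDimensional k V']
    (h : IsBlock B) (h' : IsBlock B') (hl : Linked B B') {c : Fin 2 → k}
    (hc : NondegenerateAt B c) : NondegenerateAt B' c := by
  have := h.isIndec.1
  have := h'.isIndec.1
  obtain ⟨g, p, n, q, m, hp, hq⟩ := h.exists_common_hasElementaryDivisor h'
  obtain rfl := (linked_iff hp hq).1 hl
  rwa [nondegenerateAt_iff_not_dvd hq, ← nondegenerateAt_iff_not_dvd hp]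

theorem IsBlock.linked_trans [FiniteDimensional k V] [FiniteDimensional k V']
    [FiniteDimensional k V''] (h : IsBlock B) (h' : IsBlock B') (h'' : IsBlock B'')
    (hl : Linked B B') (hl' : Linked B' B'') : Linked B B'' := by
  have := h.isIndec.1
  have := h'.isIndec.1
  have := h''.isIndec.1
  obtain ⟨c, hc⟩ := h.sloped
  have hc' := h.nondegenerateAt_of_linked h' hl hc
  have hc'' := h'.nondegenerateAt_of_linked h'' hl' hc'
  obtain ⟨g, rfl⟩ := exists_GL_row_zero_eq hc.ne_zero
  obtain ⟨p, n, hp⟩ := h.exists_hasElementaryDivisor_combo hc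
  obtain ⟨p', n', hp'⟩ := h'.exists_hasElementaryDivisor_combo hc'
  obtain ⟨p'', n'', hp''⟩ := h''.exists_hasElementaryDivisor_combo hc''
  rw [linked_iff hp hp'] at hl
  rw [linked_iff hp' hp''] at hl'
  rw [linked_iff hp hp'', hl, hl']

/-- Being linked, as an equivalence relation on the indices of a family of blocks. -/
def linkedSetoid {I : Type*} {W : I → Type*} [∀ i, AddCommGroup (W i)] [∀ i, Module k (W i)]
    [∀ i, FiniteDimensional k (W i)] {C : ∀ i, FormPair k (W i)} (hC : ∀ i, IsBlock (C i)) :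
    Setoid I where
  r i j := Linked (C i) (C j)
  iseqv := ⟨fun i => (hC i).linked_refl, fun {i j} => (hC i).linked_symm (hC j),
    fun {i j l} => (hC i).linked_trans (hC j) (hC l)⟩

end Block

end FormPair

/-! ### Families of finite sets with equal intersection counts -/

section Counting

open Finset

theorem sum_card_filter_mem {J Ω : Type*} [Fintype J] [DecidableEq Ω] (S : J → Finset Ω)
    (A : Finset Ω) : ∑ ω ∈ A, #{j | ω ∈ S j} = ∑ j, #(A ∩ S j) := by
  simp only [← filter_mem_eq_inter]
  exact sum_card_bipartiteAbove_eq_sum_card_bipartiteBelow _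

theorem sum_card_filter_mem_mul {J Ω : Type*} [Fintype J] [DecidableEq Ω] (S : J → Finset Ω)
    {U : Finset Ω} (hU : ∀ j, S j ⊆ U) (f : Ω → ℤ) :
    ∑ ω ∈ U, #{j | ω ∈ S j} * f ω = ∑ j, ∑ ω ∈ S j, f ω := by
  have sum_eq (j : J) : ∑ ω ∈ S j, f ω = ∑ ω ∈ U, if ω ∈ S j then f ω else 0 := by
    rw [← sum_filter, filter_mem_eq_inter, inter_eq_right.2 (hU j)]
  simp only [sum_eq]
  rw [sum_comm]
  refine sum_congr rfl fun ω _ => ?_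
  rw [← sum_filter, sum_const, nsmul_eq_mul]

/-- Let `D ω` be the difference of the two multiplicities of `ω`. By hypothesis `D` sums to zero
over each set of either family, hence `∑ ω, D ω ^ 2 = 0`. -/
theorem card_filter_mem_eq {J J' Ω : Type*} [Fintype J] [Fintype J'] [DecidableEq Ω]
    (S : J → Finset Ω) (S' : J' → Finset Ω)
    (h : ∀ i, ∑ j, #(S i ∩ S j) = ∑ j, #(S i ∩ S' j))
    (h' : ∀ i, ∑ j, #(S' i ∩ S j) = ∑ j, #(S' i ∩ S' j)) (ω : Ω) :
    #{j | ω ∈ S j} = #{j | ω ∈ S' j} := by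
  let D (ω : Ω) : ℤ := #{j | ω ∈ S j} - #{j | ω ∈ S' j}
  let U := insert ω (univ.biUnion S ∪ univ.biUnion S')
  have hU (j : J) : S j ⊆ U :=
    (subset_biUnion_of_mem S (mem_univ j)).trans (subset_union_left.trans (subset_insert _ _))
  have hU' (j : J') : S' j ⊆ U :=
    (subset_biUnion_of_mem S' (mem_univ j)).trans (subset_union_right.trans (subset_insert _ _))
  have sum_D {A : Finset Ω} (hA : ∑ j, #(A ∩ S j) = ∑ j, #(A ∩ S' j)) : ∑ ω ∈ A, D ω = 0 := by
    rw [sum_sub_distrib, ← Nat.cast_sum, ← Nat.cast_sum, sum_card_filter_mem, sum_card_filter_mem,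
      hA, sub_self]
  have sum_sq : ∑ ω ∈ U, D ω ^ 2 = 0 := by
    calc ∑ ω ∈ U, D ω ^ 2
        = ∑ ω ∈ U, #{j | ω ∈ S j} * D ω - ∑ ω ∈ U, #{j | ω ∈ S' j} * D ω := by
          simp only [sq, ← sum_sub_distrib, ← sub_mul, D]
      _ = 0 := by
          rw [sum_card_filter_mem_mul S hU, sum_card_filter_mem_mul S' hU',
            sum_eq_zero fun i _ => sum_D (h i), sum_eq_zero fun i _ => sum_D (h' i), sub_self]
  have sq_eq_zero := (sum_eq_zero_iff_of_nonneg fun ω _ => sq_nonneg (D ω)).1 sum_sq ω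
    (mem_insert_self _ _)
  exact Int.ofNat_inj.1 (sub_eq_zero.1 (pow_eq_zero_iff two_ne_zero |>.1 sq_eq_zero))

theorem card_filter_lt_eq_add {J Q : Type*} [Fintype J] [DecidableEq Q] (q : J → Q) (n : J → ℕ)
    (r : Q) (l : ℕ) : #{j | q j = r ∧ l < n j} =
      #{j | q j = r ∧ n j = l + 1} + #{j | q j = r ∧ l + 1 < n j} := by
  classical
  rw [← card_union_of_disjoint, ← filter_or]
  · congr 1
    ext j
    simp only [mem_filter_univ]
    lia
  · rw [disjoint_filter]
    lia

theorem exists_equiv_of_sum_min_eq {J J' Q : Type*} [Fintype J] [Fintype J'] [DecidableEq Q]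
    (q : J → Q) (n : J → ℕ) (q' : J' → Q) (n' : J' → ℕ) (hn : ∀ j, n j ≠ 0) (hn' : ∀ j, n' j ≠ 0)
    (h : ∀ i, (∑ j, if q i = q j then min (n i) (n j) else 0) =
      ∑ j, if q i = q' j then min (n i) (n' j) else 0)
    (h' : ∀ i, (∑ j, if q' i = q j then min (n' i) (n j) else 0) =
      ∑ j, if q' i = q' j then min (n' i) (n' j) else 0) :
    ∃ σ : J ≃ J', ∀ j, q j = q' (σ j) ∧ n j = n' (σ j) := by
  have card_inter (a b : Q) (m l : ℕ) : #({a} ×ˢ range m ∩ {b} ×ˢ range l) =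
      if a = b then min m l else 0 := by
    have : range m ∩ range l = range (min m l) := by
      ext
      simp
    rw [product_inter_product, this, card_product, card_range]
    split_ifs with hab
    · simp [hab]
    · simp [singleton_inter_of_notMem (notMem_singleton.2 hab)]
  have card_lt (r : Q) (l : ℕ) : #{j | q j = r ∧ l < n j} = #{j | q' j = r ∧ l < n' j} := by
    have := card_filter_mem_eq (fun j => {q j} ×ˢ range (n j)) (fun j => {q' j} ×ˢ range (n' j))
      (by simpa only [card_inter] using h) (by simpa only [card_inter] using h') (r, l)
    simpa only [mem_product, mem_singleton, mem_range, eq_comm (a := r)] using this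
  have card_fiber (c : Q × ℕ) : #{j | (q j, n j) = c} = #{j | (q' j, n' j) = c} := by
    obtain ⟨r, _ | l⟩ := c
    · simp [hn, hn']
    · simp only [Prod.mk.injEq]
      have := card_lt r l
      rw [card_filter_lt_eq_add q, card_filter_lt_eq_add q', card_lt r (l + 1)] at this
      exact Nat.add_right_cancel this
  have e (c : Q × ℕ) : {j // (q j, n j) = c} ≃ {j // (q' j, n' j) = c} :=
    Fintype.equivOfCardEq (by rw [Fintype.card_subtype, Fintype.card_subtype, card_fiber])
  exact ⟨.ofFiberEquiv e, fun j => Prod.ext_iff.1 (Equiv.ofFiberEquiv_map e j).symm⟩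

end Counting

namespace FormPair

/-! ### Uniqueness of fully refined orthogonal decompositions -/

section KrullSchmidt

variable {k : Type*} [Field k]

theorem finrank_adjointPairs_orthSum {J : Type*} [Fintype J] {V : J → Type*} {W : Type*}
    [∀ j, AddCommGroup (V j)] [∀ j, Module k (V j)] [∀ j, FiniteDimensional k (V j)]
    [AddCommGroup W] [Module k W] [FiniteDimensional k W] {B : ∀ j, FormPair k (V j)}
    {C : FormPair k W} [∀ j, Decidable (Linked C (B j))] (hB : ∀ j, IsBlock (B j))
    (hC : IsBlock C) : Module.finrank k (adjointPairs (orthSum B) C) =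
      2 * ∑ j, if Linked C (B j) then min (Module.finrank k W) (Module.finrank k (V j)) else 0 := by
  classical
  rw [(adjointPairsOrthSumEquiv B C).finrank_eq, Module.finrank_pi_fintype, Finset.mul_sum]
  refine Finset.sum_congr rfl fun j _ => ?_
  rw [finrank_adjointPairs_comm (hB j).isAlt hC.isAlt, hC.finrank_adjointPairs (hB j), mul_ite,
    mul_zero]

theorem exists_equiv_of_isometric_orthSum {I J J' : Type*} [Fintype J] [Fintype J'] {V : I → Type*}
    [∀ i, AddCommGroup (V i)] [∀ i, Module k (V i)] [∀ i, FiniteDimensional k (V i)]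
    {B : ∀ i, FormPair k (V i)} (hB : ∀ i, IsBlock (B i)) (x : J → I) (x' : J' → I)
    (h : Isometric (orthSum fun j => B (x j)) (orthSum fun j => B (x' j))) :
    ∃ σ : J ≃ J', ∀ j, Isometric (B (x j)) (B (x' (σ j))) := by
  classical
  let Q := Quotient (linkedSetoid hB)
  have mk_eq_iff (i i' : I) : (⟦i⟧ : Q) = ⟦i'⟧ ↔ Linked (B i) (B i') := Quotient.eq
  have finrank_ne_zero (i : I) : Module.finrank k (V i) ≠ 0 := by
    have := (hB i).isIndec.1
    exact Module.finrank_pos.ne'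
  have sum_eq (i : I) : (∑ j, if (⟦i⟧ : Q) = ⟦x j⟧ then
        min (Module.finrank k (V i)) (Module.finrank k (V (x j))) else 0) =
      ∑ j, if (⟦i⟧ : Q) = ⟦x' j⟧ then
        min (Module.finrank k (V i)) (Module.finrank k (V (x' j))) else 0 := by
    have finrank_eq := h.finrank_adjointPairs_eq (.refl (B i))
    rw [finrank_adjointPairs_orthSum (fun j => hB (x j)) (hB i),
      finrank_adjointPairs_orthSum (fun j => hB (x' j)) (hB i)] at finrank_eq
    simpa only [mk_eq_iff] using Nat.eq_of_mul_eq_mul_left two_pos finrank_eq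
  obtain ⟨σ, hσ⟩ := exists_equiv_of_sum_min_eq (fun j => (⟦x j⟧ : Q))
    (fun j => Module.finrank k (V (x j))) (fun j => ⟦x' j⟧) (fun j => Module.finrank k (V (x' j)))
    (fun j => finrank_ne_zero (x j)) (fun j => finrank_ne_zero (x' j)) (fun j => sum_eq (x j))
    (fun j => sum_eq (x' j))
  exact ⟨σ, fun j =>
    (hB (x j)).isometric_of_linked (hB (x' (σ j))) ((mk_eq_iff _ _).1 (hσ j).1) (hσ j).2⟩

end KrullSchmidt

/-! ### Generalized Pfaffians of blocks -/

section Pfaffian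

open Polynomial

variable {k : Type*} [Field k]

theorem aeval_genDisc {n R : Type*} [Fintype n] [DecidableEq n] [CommRing R] [Algebra k R]
    (x : Fin 2 → R) (Ψ : Fin 2 → Matrix n n k) :
    MvPolynomial.aeval x (genDisc Ψ) = (∑ i, x i • (Ψ i).map (algebraMap k R)).det := by
  rw [genDisc, AlgHom.map_det]
  congr 1
  ext a b
  simp [Fin.sum_univ_two]

variable {ι κ : Type*} [Fintype ι] [DecidableEq ι] [Fintype κ] [DecidableEq κ]
  {Φ : Fin 2 → Matrix ι ι k} {Λ : Fin 2 → Matrix κ κ k} {f f' : MvPolynomial (Fin 2) k}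

/-- The pair of bilinear forms on coordinate space given by a pair of matrices. -/
def ofMatrices (Φ : Fin 2 → Matrix ι ι k) : FormPair k (ι → k) :=
  fun i => Matrix.toBilin' (Φ i)

theorem ofMatrices_apply (Φ : Fin 2 → Matrix ι ι k) (i : Fin 2) (u v : ι → k) :
    ofMatrices Φ i u v = pairBimap Φ u v i := Matrix.toBilin'_apply' _ _ _

theorem isBlock_ofMatrices (hA : IsAltPair Φ) (hI : IsIndecPair Φ) (hS : IsSlopedPair Φ) :
    IsBlock (ofMatrices Φ) := by
  have isAlt : IsAlt (ofMatrices Φ) := fun i u => by rw [ofMatrices_apply, hA u, Pi.zero_apply]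
  have := hI.1
  refine ⟨isAlt, ⟨inferInstance, fun U W hUW ho => hI.2 U W hUW fun u hu w hw => ?_⟩, ?_⟩
  · simp only [funext_iff, ← ofMatrices_apply, isAlt.eq_neg _ w u, ho u hu w hw, neg_zero,
      Pi.zero_apply, implies_true, and_self]
  · obtain ⟨a, b, hab⟩ := hS
    refine ⟨![a, b], ?_⟩
    rw [← LinearMap.BilinForm.nondegenerate_toBilin'_iff_det_ne_zero] at hab
    simpa [NondegenerateAt, ofMatrices] using hab.1

theorem Isometric.isGenPfaffian (h : Isometric (ofMatrices Φ) (ofMatrices Λ))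
    (hf : IsGenPfaffian Φ f) : IsGenPfaffian Λ f := by
  obtain ⟨e, he⟩ := h
  obtain ⟨n, b, Ψ, hΨ, rfl⟩ := hf
  refine ⟨n, b.map e, Ψ, fun i => ?_, rfl⟩
  simpa only [Module.Basis.map_apply, ← ofMatrices_apply, he] using hΨ i

theorem IsAlt.isGenPfaffian_genDisc (h : IsAlt (ofMatrices Φ)) {n : ℕ}
    (b : Module.Basis (Fin n ⊕ Fin n) k (ι → k))
    (hl : ∀ i x y, ofMatrices Φ i (b (.inl x)) (b (.inl y)) = 0)
    (hr : ∀ i x y, ofMatrices Φ i (b (.inr x)) (b (.inr y)) = 0) :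
    IsGenPfaffian Φ (genDisc fun i => .of fun x y => ofMatrices Φ i (b (.inl x)) (b (.inr y))) := by
  refine ⟨n, b, _, fun i => ?_, rfl⟩
  ext (x | x) (y | y)
  · simpa [← ofMatrices_apply] using hl i x y
  · simp [← ofMatrices_apply]
  · simpa [← ofMatrices_apply] using h.eq_neg i _ _
  · simpa [← ofMatrices_apply] using hr i x y

section FunctionalGram

variable {R A n : Type*} [CommRing R] [CommRing A] [Algebra R A] [Fintype n] [DecidableEq n]

/-- The Gram matrix, relative to the basis `c`, of the bilinear form `(u, v) ↦ φ (a u v)` of an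
algebra. -/
noncomputable def functionalGram (φ : A →ₗ[R] R) (c : Module.Basis n R A) (a : A) : Matrix n n R :=
  .of fun x y => φ (a * (c x * c y))

theorem functionalGram_eq_mul_leftMulMatrix (φ : A →ₗ[R] R) (c : Module.Basis n R A) (a : A) :
    functionalGram φ c a = functionalGram φ c 1 * Algebra.leftMulMatrix c a := by
  ext x y
  have mul_basis : a * c y = ∑ z, Algebra.leftMulMatrix c a z y • c z := by
    simp_rw [Algebra.leftMulMatrix_eq_repr_mul]
    exact (c.sum_repr _).symm
  simp only [functionalGram, Matrix.of_apply, Matrix.mul_apply, one_mul, mul_left_comm a, mul_basis,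
    Finset.mul_sum, mul_smul_comm, map_sum, map_smul, smul_eq_mul, mul_comm]

theorem det_X_smul_functionalGram_sub (φ : A →ₗ[R] R) (h : PowerBasis R A) :
    ((X : R[X]) • (functionalGram φ h.basis 1).map C - (functionalGram φ h.basis h.gen).map C).det =
      C (functionalGram φ h.basis 1).det * minpoly R h.gen := by
  have factor : (X : R[X]) • (functionalGram φ h.basis 1).map C -
      (functionalGram φ h.basis h.gen).map C = (functionalGram φ h.basis 1).map C *
        (Algebra.leftMulMatrix h.basis h.gen).charmatrix := by
    rw [Matrix.charmatrix, Matrix.mul_sub, Matrix.scalar_apply, ← Matrix.smul_eq_mul_diagonal,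
      functionalGram_eq_mul_leftMulMatrix φ _ h.gen, Matrix.map_mul, RingHom.mapMatrix_apply]
  rw [factor, Matrix.det_mul, ← charpoly_leftMulMatrix, Matrix.charpoly, ← RingHom.mapMatrix_apply,
    ← RingHom.map_det]

theorem det_functionalGram_one_ne_zero {φ : A →ₗ[R] R} [IsDomain R]
    (hφ : ∀ a, a ≠ 0 → ∃ b, φ (a * b) ≠ 0) (c : Module.Basis n R A) :
    (functionalGram φ c 1).det ≠ 0 := by
  have : functionalGram φ c 1 = LinearMap.toMatrix₂ c c ((LinearMap.mul R A).compr₂ φ) := by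
    ext x y
    simp [functionalGram, LinearMap.toMatrix₂_apply]
  rw [this, ← LinearMap.separatingLeft_iff_det_ne_zero c]
  intro a ha
  contrapose! ha
  exact hφ a ha

end FunctionalGram

theorem associated_aeval_genDisc {μ : k[X]} (hμ : μ.Monic) {g : Matrix (Fin 2) (Fin 2) k}
    {Ψ : Fin 2 → Matrix (Fin (AdjoinRoot.powerBasis' hμ).dim)
      (Fin (AdjoinRoot.powerBasis' hμ).dim) k}
    (hΨ : ∀ i, ∑ j, g i j • Ψ j = functionalGram (topCoeff hμ) (AdjoinRoot.powerBasis' hμ).basis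
      (AdjoinRoot.root μ ^ (i : ℕ))) :
    Associated (MvPolynomial.aeval (fun j => X * C (g 0 j) - C (g 1 j)) (genDisc Ψ)) μ := by
  have pencil : ∑ j, (X * C (g 0 j) - C (g 1 j)) • (Ψ j).map (algebraMap k k[X]) =
      (X : k[X]) • (∑ j, g 0 j • Ψ j).map C - (∑ j, g 1 j • Ψ j).map C := by
    ext1 x y
    simp [Fin.sum_univ_two]
    ring
  have minpoly_gen : minpoly k (AdjoinRoot.powerBasis' hμ).gen = μ := by
    rw [AdjoinRoot.powerBasis'_gen, AdjoinRoot.minpoly_root hμ.ne_zero, hμ.leadingCoeff, inv_one,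
      C_1, mul_one]
  rw [aeval_genDisc, pencil, hΨ, hΨ, Fin.val_zero, Fin.val_one, pow_zero, pow_one,
    ← AdjoinRoot.powerBasis'_gen hμ, det_X_smul_functionalGram_sub, minpoly_gen]
  exact associated_unit_mul_left _ _ (isUnit_C.2
    (det_functionalGram_one_ne_zero (exists_topCoeff_mul_ne_zero hμ) _).isUnit)

/-- In the coordinates of `k²` in which the pair becomes `model hμ`, its generalized Pfaffian
dehomogenizes to `μ`. -/
theorem exists_isGenPfaffian_associated (h : IsAlt (ofMatrices Φ)) {μ : k[X]} {hμ : μ.Monic}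
    {g : GL (Fin 2) k} (hg : Isometric (combo g (ofMatrices Φ)) (model hμ)) :
    ∃ f, IsGenPfaffian Φ f ∧
      Associated (MvPolynomial.aeval (fun j => X * C (g 0 j) - C (g 1 j)) f) μ := by
  obtain ⟨e, he⟩ := hg
  let c := (AdjoinRoot.powerBasis' hμ).basis.prod (AdjoinRoot.powerBasis' hμ).basis
  let b := c.map e.symm
  have combo_apply_b (i x y) :
      combo g (ofMatrices Φ) i (b x) (b y) = model hμ i (c x) (c y) := by
    rw [← he, Module.Basis.map_apply, Module.Basis.map_apply, e.apply_symm_apply,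
      e.apply_symm_apply]
  have eq_zero_of_combo {x y} (hxy : ∀ i, combo g (ofMatrices Φ) i (b x) (b y) = 0) (i) :
      ofMatrices Φ i (b x) (b y) = 0 := by
    rw [← combo_inv_combo g (ofMatrices Φ), combo_apply]
    simp only [hxy, mul_zero, Finset.sum_const_zero]
  have hl (i x y) : ofMatrices Φ i (b (.inl x)) (b (.inl y)) = 0 :=
    eq_zero_of_combo (fun i => by simp [combo_apply_b, c, model, detPair_apply]) i
  have hr (i x y) : ofMatrices Φ i (b (.inr x)) (b (.inr y)) = 0 :=
    eq_zero_of_combo (fun i => by simp [combo_apply_b, c, model, detPair_apply]) i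
  refine ⟨_, h.isGenPfaffian_genDisc b hl hr, associated_aeval_genDisc hμ fun i => ?_⟩
  ext x y
  have := combo_apply_b i (.inl x) (.inr y)
  rw [combo_apply] at this
  simpa [Matrix.sum_apply, functionalGram, c, model, detPair_apply] using this

theorem associated_aeval_of_eqModScalars (h : EqModScalars f f') (x : Fin 2 → k[X]) :
    Associated (MvPolynomial.aeval x f) (MvPolynomial.aeval x f') := by
  obtain ⟨c, hc, rfl⟩ := h
  rw [map_mul, MvPolynomial.aeval_C]
  exact associated_unit_mul_right _ _ (isUnit_C.2 hc.isUnit)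

theorem IsBlock.exists_isGenPfaffian (h : IsBlock (ofMatrices Φ)) : ∃ f, IsGenPfaffian Φ f := by
  obtain ⟨g, p, n, -, -, ⟨-, -, hp, hiso⟩, -⟩ := h.exists_common_hasElementaryDivisor h
  obtain ⟨f, hf, -⟩ := exists_isGenPfaffian_associated h.isAlt hiso
  exact ⟨f, hf⟩

theorem IsBlock.isometric_of_eqModScalars (hΦ : IsBlock (ofMatrices Φ))
    (hΛ : IsBlock (ofMatrices Λ)) (hf : IsGenPfaffian Φ f) (hf' : IsGenPfaffian Λ f')
    (h : EqModScalars f f') : Isometric (ofMatrices Φ) (ofMatrices Λ) := by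
  obtain ⟨g, p, n, q, m, hp, hq⟩ := hΦ.exists_common_hasElementaryDivisor hΛ
  have ⟨hp_irr, hn, hp_monic, hp_iso⟩ := hp
  have ⟨hq_irr, _, hq_monic, hq_iso⟩ := hq
  obtain ⟨F, hF, associated_F⟩ := exists_isGenPfaffian_associated hΦ.isAlt hp_iso
  obtain ⟨F', hF', associated_F'⟩ := exists_isGenPfaffian_associated hΛ.isAlt hq_iso
  have pow_eq_pow : p ^ n = q ^ m := eq_of_monic_of_associated (hp_monic.pow n) (hq_monic.pow m) <|
    associated_F.symm.trans <| (associated_aeval_of_eqModScalars (hF.unique hf) _).trans <|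
      (associated_aeval_of_eqModScalars h _).trans <|
        (associated_aeval_of_eqModScalars (hf'.unique hF') _).trans associated_F'
  obtain rfl : p = q := eq_of_monic_of_associated hp_monic hq_monic <| hp_irr.associated_of_dvd
    hq_irr <| hp_irr.prime.dvd_of_dvd_pow (pow_eq_pow ▸ dvd_pow_self p hn)
  rw [← isometric_combo_iff g]
  refine hp.isometric hq ?_
  rw [hp.finrank_eq, hq.finrank_eq, ← natDegree_pow p n, ← natDegree_pow p m, pow_eq_pow]

end Pfaffian

end FormPair

namespace GammaL2

/-! ### Semilinear changes of coordinates -/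

variable {k : Type*} [Field k] {ι κ : Type*}

/-- The semilinear automorphism of `k^ι` applying a field automorphism to each coordinate. -/
def coordMap (ι : Type*) (τ : k ≃+* k) :
    letI := RingHomInvPair.of_ringEquiv τ
    letI := RingHomInvPair.of_ringEquiv_symm τ
    (ι → k) ≃ₛₗ[(τ : k →+* k)] (ι → k) :=
  letI := RingHomInvPair.of_ringEquiv τ
  letI := RingHomInvPair.of_ringEquiv_symm τ
  { Equiv.piCongrRight fun _ : ι => τ.toEquiv with
    map_add' := fun u v => funext fun i => map_add τ (u i) (v i)
    map_smul' := fun c u => funext fun i => map_mul τ c (u i) }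

/-- The basis of `k^ι` obtained by applying a field automorphism to the coordinates of the vectors
of a basis. -/
noncomputable def mapBasis [Finite κ] (τ : k ≃+* k) (b : Module.Basis κ k (ι → k)) :
    Module.Basis κ k (ι → k) :=
  letI := RingHomInvPair.of_ringEquiv τ
  letI := RingHomInvPair.of_ringEquiv_symm τ
  .ofEquivFun ((coordMap ι τ).symm.trans (b.equivFun.trans (coordMap κ τ)))

theorem mapBasis_apply [Finite κ] (τ : k ≃+* k) (b : Module.Basis κ k (ι → k)) (p : κ) :
    mapBasis τ b p = τ ∘ b p := by
  classical
  have := RingHomInvPair.of_ringEquiv τ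
  have := RingHomInvPair.of_ringEquiv_symm τ
  rw [mapBasis, Module.Basis.coe_ofEquivFun, LinearEquiv.symm_apply_eq]
  ext x
  have symm_comp : τ.symm ∘ τ ∘ b p = b p := funext fun i => τ.symm_apply_apply _
  change _ = τ (b.equivFun (τ.symm ∘ τ ∘ b p) x)
  rw [symm_comp, b.equivFun_self]
  simp [Pi.single_apply, apply_ite, eq_comm]

theorem act_zero (A : GammaL2 k) : A.act 0 = 0 := by
  simp only [act, Pi.zero_apply, map_zero]
  exact Matrix.zero_vecMul _

theorem act_smul (A : GammaL2 k) (c : k) (w : Fin 2 → k) : A.act (c • w) = A.aut c • A.act w := by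
  rw [act, act, ← Matrix.smul_vecMul]
  congr 1
  exact funext fun i => map_mul A.aut c (w i)

theorem act_eq_zero_iff (A : GammaL2 k) {w : Fin 2 → k} : A.act w = 0 ↔ w = 0 := by
  refine ⟨fun h => funext fun i => ?_, fun h => h ▸ A.act_zero⟩
  have := Matrix.vecMul_injective_of_isUnit A.mat.isUnit (h.trans (Matrix.zero_vecMul _).symm)
  simpa using congrFun this i

/-- The pair of matrices representing the bimap `(u, v) ↦ (u^{τ⁻¹} ∘ v^{τ⁻¹}) A`, where `τ` is the
field automorphism of `A`. -/
def twist (A : GammaL2 k) (Φ : Fin 2 → Matrix ι ι k) : Fin 2 → Matrix ι ι k :=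
  fun i => ∑ j, A.mat j i • (Φ j).map A.aut

variable [Fintype ι]

theorem pairBimap_twist (A : GammaL2 k) (Φ : Fin 2 → Matrix ι ι k) (u v : ι → k) :
    pairBimap (A.twist Φ) (A.aut ∘ u) (A.aut ∘ v) = A.act (pairBimap Φ u v) := by
  have apply_map (j : Fin 2) : (A.aut ∘ u) ⬝ᵥ ((Φ j).map A.aut *ᵥ (A.aut ∘ v)) =
      A.aut (u ⬝ᵥ (Φ j *ᵥ v)) := by
    simp [dotProduct, Matrix.mulVec, map_sum]
  ext i
  simp only [pairBimap, twist, act, Matrix.sum_mulVec, Matrix.smul_mulVec, dotProduct_sum,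
    dotProduct_smul, apply_map, smul_eq_mul]
  exact Finset.sum_congr rfl fun j _ => mul_comm _ _

theorem pairBimap_twist_apply (A : GammaL2 k) (Φ : Fin 2 → Matrix ι ι k) (u v : ι → k) :
    pairBimap (A.twist Φ) u v = A.act (pairBimap Φ (A.aut.symm ∘ u) (A.aut.symm ∘ v)) := by
  simp [← pairBimap_twist, Function.comp_def]

theorem isAltPair_twist (A : GammaL2 k) {Φ : Fin 2 → Matrix ι ι k} (h : IsAltPair Φ) :
    IsAltPair (A.twist Φ) := fun u => by
  rw [pairBimap_twist_apply, h, act_zero]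

theorem isIndecPair_twist (A : GammaL2 k) {Φ : Fin 2 → Matrix ι ι k} (h : IsIndecPair Φ) :
    IsIndecPair (A.twist Φ) := by
  have := RingHomInvPair.of_ringEquiv A.aut
  have := RingHomInvPair.of_ringEquiv_symm A.aut
  let E : Submodule k (ι → k) ≃o Submodule k (ι → k) :=
    Submodule.orderIsoMapComap (coordMap ι A.aut)
  refine ⟨h.1, fun U W hUW ho => ?_⟩
  have eq_bot_or : E.symm U = ⊥ ∨ E.symm W = ⊥ :=
    h.2 (E.symm U) (E.symm W) (E.symm.isCompl hUW) fun u hu w hw => by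
      simpa only [pairBimap_twist, act_eq_zero_iff] using ho (A.aut ∘ u) hu (A.aut ∘ w) hw
  simpa only [map_eq_bot_iff] using eq_bot_or

theorem isSlopedPair_twist [DecidableEq ι] (A : GammaL2 k) {Φ : Fin 2 → Matrix ι ι k}
    (h : IsSlopedPair Φ) : IsSlopedPair (A.twist Φ) := by
  obtain ⟨a, b, hab⟩ := h
  let x : Fin 2 → k := A.mat⁻¹.1 *ᵥ ![A.aut a, A.aut b]
  have mulVec_x : A.mat.1 *ᵥ x = ![A.aut a, A.aut b] := by
    rw [Matrix.mulVec_mulVec, ← Units.val_mul, mul_inv_cancel, Units.val_one, Matrix.one_mulVec]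
  have h₀ : A.mat 0 0 * x 0 + A.mat 0 1 * x 1 = A.aut a := by
    simpa [Matrix.mulVec, dotProduct] using congrFun mulVec_x 0
  have h₁ : A.mat 1 0 * x 0 + A.mat 1 1 * x 1 = A.aut b := by
    simpa [Matrix.mulVec, dotProduct] using congrFun mulVec_x 1
  have combination_eq : x 0 • A.twist Φ 0 + x 1 • A.twist Φ 1 =
      (A.aut : k →+* k).mapMatrix (a • Φ 0 + b • Φ 1) := by
    ext p q
    simp only [twist, Fin.sum_univ_two, Matrix.add_apply, Matrix.smul_apply, Matrix.map_apply,
      smul_eq_mul, RingHom.mapMatrix_apply, map_add, map_mul, RingHom.coe_coe, ← h₀, ← h₁]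
    ring
  refine ⟨x 0, x 1, ?_⟩
  rw [combination_eq, ← RingHom.map_det]
  exact (map_ne_zero _).2 hab

theorem genDisc_twist [DecidableEq ι] (A : GammaL2 k) (Ψ : Fin 2 → Matrix ι ι k) :
    genDisc (A.twist Ψ) = A.polyAct (genDisc Ψ) := by
  rw [polyAct, genDisc, genDisc, RingHom.map_det, AlgHom.map_det]
  congr 1
  ext1 p q
  simp only [twist, Fin.sum_univ_two, RingHom.mapMatrix_apply, AlgHom.mapMatrix_apply,
    Matrix.add_apply, Matrix.smul_apply, Matrix.map_apply, smul_eq_mul, map_add, map_mul,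
    MvPolynomial.map_X, MvPolynomial.map_C, MvPolynomial.bind₁_X_right,
    MvPolynomial.bind₁_C_right, RingHom.coe_coe]
  ring

theorem isGenPfaffian_twist (A : GammaL2 k) {Φ : Fin 2 → Matrix ι ι k}
    {f : MvPolynomial (Fin 2) k} (hf : IsGenPfaffian Φ f) :
    IsGenPfaffian (A.twist Φ) (A.polyAct f) := by
  obtain ⟨n, b, Ψ, hΨ, rfl⟩ := hf
  refine ⟨n, mapBasis A.aut b, A.twist Ψ, fun i => ?_, (genDisc_twist A Ψ).symm⟩
  have pairBimap_basis (p q j) : pairBimap Φ (b p) (b q) j =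
      Matrix.fromBlocks 0 (Ψ j) (-(Ψ j)ᵀ) 0 p q := congrFun₂ (hΨ j) p q
  ext (p | p) (q | q) <;>
    simp [mapBasis_apply, pairBimap_twist, act, Matrix.vecMul, dotProduct, pairBimap_basis, twist,
      mul_comm, add_comm]

theorem twist_diagPair (A : GammaL2 k) {s : ℕ} {d : Fin s → ℕ}
    (Φ : ∀ j : Fin s, Fin 2 → Matrix (Fin (d j)) (Fin (d j)) k) :
    A.twist (diagPair Φ) = diagPair fun j => A.twist (Φ j) := by
  funext i
  ext ⟨x, a⟩ ⟨y, b⟩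
  simp only [twist, diagPair, Fin.sum_univ_two, Matrix.add_apply, Matrix.smul_apply,
    Matrix.map_apply, Matrix.blockDiagonal'_apply, smul_eq_mul]
  split_ifs with hxy
  · subst hxy
    rfl
  · simp only [map_zero, mul_zero, add_zero]

end GammaL2

namespace FormPair

/-! ### Pseudo-isometries as isometries of twisted pairs -/

section PseudoIsometry

variable {k : Type*} [Field k] {ι κ : Type*} [Fintype ι] [Fintype κ]

theorem pairBimap_smul_left (Φ : Fin 2 → Matrix ι ι k) (c : k) (u v : ι → k) :
    pairBimap Φ (c • u) v = c • pairBimap Φ u v :=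
  funext fun i => smul_dotProduct c u (Φ i *ᵥ v)

theorem eq_aut_of_pairBimap_ne_zero {A : GammaL2 k} {Φ : Fin 2 → Matrix ι ι k}
    {Λ : Fin 2 → Matrix κ κ k} {ρ : k ≃+* k} {α : (ι → k) →ₛₗ[(ρ : k →+* k)] (κ → k)}
    (h : ∀ u v, pairBimap Λ (α u) (α v) = A.act (pairBimap Φ u v)) {u v : ι → k}
    (huv : pairBimap Φ u v ≠ 0) : ρ = A.aut := by
  ext c
  have smul_eq : ρ c • A.act (pairBimap Φ u v) = A.aut c • A.act (pairBimap Φ u v) := by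
    rw [← A.act_smul, ← h, ← pairBimap_smul_left, ← pairBimap_smul_left, ← h, α.map_smulₛₗ]
    rfl
  exact smul_left_injective k (mt A.act_eq_zero_iff.1 huv) smul_eq

variable [DecidableEq ι] [DecidableEq κ]

theorem liftsToPseudoIsometry_iff (A : GammaL2 k) (Φ : Fin 2 → Matrix ι ι k)
    (Λ : Fin 2 → Matrix κ κ k) :
    LiftsToPseudoIsometry A Φ Λ ↔ Isometric (ofMatrices (A.twist Φ)) (ofMatrices Λ) := by
  constructor
  · rintro ⟨ρ, α, hα, h⟩
    have := RingHomInvPair.of_ringEquiv ρ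
    have := RingHomInvPair.of_ringEquiv_symm ρ
    refine ⟨(GammaL2.coordMap ι ρ).symm.trans (LinearEquiv.ofBijective α hα), fun i u v => ?_⟩
    rw [ofMatrices_apply, ofMatrices_apply, GammaL2.pairBimap_twist_apply]
    change pairBimap Λ (α (ρ.symm ∘ u)) (α (ρ.symm ∘ v)) i = _
    rw [h]
    by_cases hΦ : ∀ u v, pairBimap Φ u v = 0
    · rw [hΦ, hΦ]
    · push Not at hΦ
      obtain ⟨x, y, hxy⟩ := hΦ
      rw [eq_aut_of_pairBimap_ne_zero h hxy]
  · rintro ⟨e, he⟩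
    have := RingHomInvPair.of_ringEquiv A.aut
    have := RingHomInvPair.of_ringEquiv_symm A.aut
    let α : (ι → k) ≃ₛₗ[(A.aut : k →+* k)] (κ → k) := (GammaL2.coordMap ι A.aut).trans e
    refine ⟨A.aut, α, α.bijective, fun u v => ?_⟩
    rw [← GammaL2.pairBimap_twist]
    funext i
    rw [← ofMatrices_apply, ← ofMatrices_apply]
    exact he i (A.aut ∘ u) (A.aut ∘ v)

theorem isometric_twist_iff {A : GammaL2 k} {Φ : Fin 2 → Matrix ι ι k}
    {Λ : Fin 2 → Matrix κ κ k} (hΦ : IsBlock (ofMatrices Φ))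
    (hA : IsBlock (ofMatrices (A.twist Φ))) (hΛ : IsBlock (ofMatrices Λ)) :
    Isometric (ofMatrices (A.twist Φ)) (ofMatrices Λ) ↔
      ∃ f g : MvPolynomial (Fin 2) k, IsGenPfaffian Φ f ∧ IsGenPfaffian Λ g ∧
        EqModScalars (A.polyAct f) g := by
  constructor
  · intro h
    obtain ⟨f, hf⟩ := hΦ.exists_isGenPfaffian
    refine ⟨f, A.polyAct f, hf, h.isGenPfaffian (A.isGenPfaffian_twist hf), 1, one_ne_zero, ?_⟩
    rw [map_one, one_mul]
  · rintro ⟨f, g, hf, hg, hfg⟩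
    exact hA.isometric_of_eqModScalars hΛ (A.isGenPfaffian_twist hf) hg hfg

end PseudoIsometry

section DiagPair

variable {k : Type*} [Field k] {s t : ℕ} {d : Fin s → ℕ} {e : Fin t → ℕ}

theorem isometric_diagPair (Φ : ∀ j : Fin s, Fin 2 → Matrix (Fin (d j)) (Fin (d j)) k) :
    Isometric (ofMatrices (diagPair Φ)) (orthSum fun j => ofMatrices (Φ j)) := by
  let curry : ((Σ j, Fin (d j)) → k) ≃ₗ[k] (∀ j, Fin (d j) → k) :=
    { Equiv.piCurry (fun _ _ => k) with
      map_add' := fun _ _ => rfl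
      map_smul' := fun _ _ => rfl }
  refine ⟨curry, fun i u v => ?_⟩
  have curry_apply (u j a) : curry u j a = u ⟨j, a⟩ := rfl
  have mulVec_apply (x : Fin s) (a : Fin (d x)) :
      (blockDiagonal' (fun j => Φ j i) *ᵥ v) ⟨x, a⟩ = (Φ x i *ᵥ curry v x) a := by
    simp only [Matrix.mulVec, dotProduct, Fintype.sum_sigma, curry_apply]
    rw [Finset.sum_eq_single x (fun y _ hy => Finset.sum_eq_zero fun b _ => by
      rw [blockDiagonal'_apply_ne _ _ _ hy.symm, zero_mul]) (by simp)]
    simp only [blockDiagonal'_apply_eq]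
  simp only [orthSum_apply, ofMatrices_apply, pairBimap, diagPair, dotProduct, Fintype.sum_sigma,
    mulVec_apply, curry_apply]

theorem liftsToPseudoIsometry_diagPair_iff (A : GammaL2 k)
    (Φ : ∀ j : Fin s, Fin 2 → Matrix (Fin (d j)) (Fin (d j)) k)
    (Λ : ∀ j : Fin t, Fin 2 → Matrix (Fin (e j)) (Fin (e j)) k) :
    LiftsToPseudoIsometry A (diagPair Φ) (diagPair Λ) ↔
      Isometric (orthSum fun j => ofMatrices (ι := Fin (d j)) (A.twist (Φ j)))
        (orthSum fun j => ofMatrices (ι := Fin (e j)) (Λ j)) := by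
  rw [liftsToPseudoIsometry_iff, GammaL2.twist_diagPair]
  exact ⟨fun h => (isometric_diagPair _).symm.trans (h.trans (isometric_diagPair Λ)),
    fun h => (isometric_diagPair _).trans (h.trans (isometric_diagPair Λ).symm)⟩

theorem exists_equiv_of_isometric_orthSum_ofMatrices
    {Φ : ∀ j : Fin s, Fin 2 → Matrix (Fin (d j)) (Fin (d j)) k}
    {Λ : ∀ j : Fin t, Fin 2 → Matrix (Fin (e j)) (Fin (e j)) k}
    (hΦ : ∀ j, IsBlock (ofMatrices (Φ j))) (hΛ : ∀ j, IsBlock (ofMatrices (Λ j)))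
    (h : Isometric (orthSum fun j => ofMatrices (ι := Fin (d j)) (Φ j))
      (orthSum fun j => ofMatrices (ι := Fin (e j)) (Λ j))) :
    ∃ σ : Fin s ≃ Fin t, ∀ j, Isometric (ofMatrices (Φ j)) (ofMatrices (Λ (σ j))) := by
  let Block := Σ n : ℕ, {Φ : Fin 2 → Matrix (Fin n) (Fin n) k // IsBlock (ofMatrices Φ)}
  let x (j : Fin s) : Block := ⟨d j, Φ j, hΦ j⟩
  let y (j : Fin t) : Block := ⟨e j, Λ j, hΛ j⟩
  exact exists_equiv_of_isometric_orthSum (V := fun i : Block => Fin i.1 → k)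
    (B := fun i => ofMatrices i.2.1) (fun i => i.2.2) x y h

end DiagPair

end FormPair

open FormPair

theorem theorem3p14 {k : Type*} [Field k] {s t : ℕ} {d : Fin s → ℕ} {e : Fin t → ℕ}
    (Φ : ∀ j : Fin s, Fin 2 → Matrix (Fin (d j)) (Fin (d j)) k)
    (Λ : ∀ j : Fin t, Fin 2 → Matrix (Fin (e j)) (Fin (e j)) k)
    (hΦalt : ∀ j, IsAltPair (Φ j)) (hΛalt : ∀ j, IsAltPair (Λ j))
    (hΦind : ∀ j, IsIndecPair (Φ j)) (hΛind : ∀ j, IsIndecPair (Λ j))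
    (hΦslo : ∀ j, IsSlopedPair (Φ j)) (hΛslo : ∀ j, IsSlopedPair (Λ j))
    (αhat : GammaL2 k) :
    LiftsToPseudoIsometry αhat (diagPair Φ) (diagPair Λ) ↔
      ∃ (h : s = t) (σ : Equiv.Perm (Fin s)), ∀ i : Fin s,
        ∃ f g : MvPolynomial (Fin 2) k,
          IsGenPfaffian (Φ i) f ∧ IsGenPfaffian (Λ (Fin.cast h (σ i))) g ∧
            EqModScalars (αhat.polyAct f) g := by
  have hΦ (j) : IsBlock (ofMatrices (Φ j)) := isBlock_ofMatrices (hΦalt j) (hΦind j) (hΦslo j)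
  have hA (j : Fin s) : IsBlock (ofMatrices (αhat.twist (Φ j))) :=
    isBlock_ofMatrices (αhat.isAltPair_twist (hΦalt j)) (αhat.isIndecPair_twist (hΦind j))
      (αhat.isSlopedPair_twist (hΦslo j))
  have hΛ (j) : IsBlock (ofMatrices (Λ j)) := isBlock_ofMatrices (hΛalt j) (hΛind j) (hΛslo j)
  rw [liftsToPseudoIsometry_diagPair_iff]
  constructor
  · intro h
    obtain ⟨σ, hσ⟩ := exists_equiv_of_isometric_orthSum_ofMatrices hA hΛ h
    obtain rfl : s = t := Fin.equiv_iff_eq.1 ⟨σ⟩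
    exact ⟨rfl, σ, fun j => (isometric_twist_iff (hΦ j) (hA j) (hΛ (σ j))).1 (hσ j)⟩
  · rintro ⟨rfl, σ, hσ⟩
    exact Isometric.orthSum σ fun j =>
      (isometric_twist_iff (hΦ j) (hA j) (hΛ (σ j))).2 (hσ j)
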